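/- Let $S$ be a countable set of signal names and let $\mathit{Int}=\mathit{Input}\cup\mathit{Output}\subseteq S$ be such that $S\setminus\mathit{Int}$ is infinite. All terms are taken up to renaming of bound signal names, and $;$ is taken up to associativity. **Source language.** Threads are $T::=0\mid T;T\mid \mathsf{emit}\,s\mid \nu s\,T\mid \mathsf{thread}\,T\mid \mathsf{await}\,s\mid \mathsf{watch}\,s\,T\mid A(\vec s)$, where each identifier $A$ has exactly one equation $A(\vec x)=T$ in which the free signal names $\mathrm{sig}(T)$ of $T$ are among $\vec x$. For an environment $E$ (a partial function from $S$ to $\{\mathit{true},\mathit{false}\}$), the reduction $(T,E)\xrightarrow{P}(T',E')$, with $P$ the multiset of spawned threads, is given by $(0;T,E)\xrightarrow{\emptyset}(T,E)$; $(\mathsf{emit}\,s,E)\xrightarrow{\emptyset}(0,E[\mathit{true}/s])$; $(\mathsf{watch}\,s\,0,E)\xrightarrow{\emptyset}(0,E)$; $(\nu s\,T,E)\xrightarrow{\emptyset}(T,E[\mathit{false}/s])$ if $s\notin\mathrm{dom}(E)$; $(A(\vec s),E)\xrightarrow{\emptyset}([\vec s/\vec x]T,E)$ if $A(\vec x)=T$;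 $(\mathsf{await}\,s,E)\xrightarrow{\emptyset}(0,E)$ if $E(s)=\mathit{true}$; $(\mathsf{thread}\,T,E)\xrightarrow{\{T\}}(0,E)$; and it is closed under the evaluation contexts generated by $[\,]$, $C;T$ and $\mathsf{watch}\,s\,C$. On suspended (irreducible) threads the evaluation at the end of the instant is $\lfloor 0\rfloor_E=0$, $\lfloor T;T'\rfloor_E=\lfloor T\rfloor_E;T'$, $\lfloor\mathsf{await}\,s\rfloor_E=\mathsf{await}\,s$, and $\lfloor\mathsf{watch}\,s\,T\rfloor_E=0$ if $E(s)=\mathit{true}$, $=\mathsf{watch}\,s\,\lfloor T\rfloor_E$ otherwise. **Target language.** Tail recursive threads are $t::=0\mid A(\vec s)\mid \mathsf{emit}\,s.t\mid \nu s\,t\mid\mathsf{thread}\,t.t\mid\mathsf{present}\,s\,t\,b$ with branching threads $b::=t\mid\mathsf{ite}\,s\,b\,b$, again with one equation per identifier. Reduction: $(\mathsf{emit}\,s.t,E)\xrightarrow{\emptyset}(t,E[\mathit{true}/s])$; $(\nu s\,t,E)\xrightarrow{\emptyset}(t,E[\mathit{false}/s])$ if $s\notin\mathrm{dom}(E)$;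 $(A(\vec s),E)\xrightarrow{\emptyset}([\vec s/\vec x]t,E)$ if $A(\vec x)=t$; $(\mathsf{present}\,s\,t\,b,E)\xrightarrow{\emptyset}(t,E)$ if $E(s)=\mathit{true}$; $(\mathsf{thread}\,t'.t,E)\xrightarrow{\{t'\}}(t,E)$. At the end of the instant $\lfloor 0\rfloor_E=0$ and $\lfloor\mathsf{present}\,s\,t\,b\rfloor_E=\langle b\rangle_E$, where $\langle t\rangle_E=t$, and $\langle\mathsf{ite}\,s\,b_1\,b_2\rangle_E$ is $\langle b_1\rangle_E$ if $E(s)=\mathit{true}$ and $\langle b_2\rangle_E$ if $E(s)=\mathit{false}$. **Programs and traces** (for both languages). A program is a finite non-empty multiset of threads; $(P\cup\{T\},E)\to(P\cup\{T'\}\cup P'',E')$ if $(T,E)\xrightarrow{P''}(T',E')$; $(P,E)$ is suspended if each of its threads is irreducible in $E$. For $I\subseteq\mathit{Input}$ let $E_{I,P}$ be true on $I$, false on $(\mathit{Int}\cup\mathrm{sig}(P))\setminus I$ and undefined elsewhere. Then $P\xrightarrow{I/O}\lfloor P'\rfloor_{E'}$ holds if $(P,E_{I,P})\to^*(P',E')$,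 $(P',E')$ is suspended and $O=\{s\in\mathit{Output}\mid E'(s)=\mathit{true}\}$. A complete run of $P$ is a sequence of transitions $P\xrightarrow{I_1/O_1}P_1\xrightarrow{I_2/O_2}\cdots$ that is infinite, or finite and not extendable, and $\mathrm{tr}(P)$ is the set of the finite or infinite words $(I_1/O_1)(I_2/O_2)\cdots$ of the complete runs of $P$. **CPS translation.** For a tail recursive thread $t$ and a sequence $\tau=(s_1,t_1)\cdots(s_m,t_m)$ of signals and tail recursive threads, define $[\![0]\!](t,\tau)=t$; $[\![T_1;T_2]\!](t,\tau)=[\![T_1]\!]([\![T_2]\!](t,\tau),\tau)$; $[\![\mathsf{emit}\,s]\!](t,\tau)=\mathsf{emit}\,s.t$; $[\![\nu s\,T]\!](t,\tau)=\nu s\,[\![T]\!](t,\tau)$ with $s$ not free in $t,\tau$; $[\![\mathsf{thread}\,T]\!](t,\tau)=\mathsf{thread}\,[\![T]\!](0,\epsilon).t$; $[\![\mathsf{watch}\,s\,T]\!](t,\tau)=[\![T]\!](t,\tau\cdot(s,t))$; $[\![\mathsf{await}\,s]\!](t,\tau)=\mathsf{present}\,s\,t\,b$ with $b=\mathsf{ite}\,s_1\,t_1(\cdots(\mathsf{ite}\,s_m\,t_m\,B)\cdots)$,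 where $B$ is an identifier whose parameters are the free names of $s,t,\tau$ and whose equation is $B=\mathsf{present}\,s\,t\,b$; $[\![A(\vec s)]\!](t,\tau)=A^{(t,\tau)}(\vec s,\vec s')$, where $\vec s'$ lists the names free in $(t,\tau)$ and $A^{(t,\tau)}$ is an identifier with equation $A^{(t,\tau)}(\vec x,\vec s')=[\![T]\!](t,\tau)$ if $A(\vec x)=T$, $\{\vec x\}\cap\{\vec s'\}=\emptyset$. The system of equations for the identifiers $B$ and $A^{(t,\tau)}$ may be infinite. For a program $P$ let $[\![P]\!]$ be the multiset of the $[\![T]\!](0,\epsilon)$ for $T\in P$. **Theorem.** For every system of source equations and every source program $P$, $\mathrm{tr}(P)=\mathrm{tr}([\![P]\!])$. -/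

import Mathlib

namespace SL

/-! ### Environments and the layer common to the two languages -/

/-- Environments: partial functions from signal names to booleans (`none` is "undefined"). -/
abbrev Env (S : Type) : Type := S → Option Bool

/-- `E[b/s]`. -/
noncomputable def Env.set {S : Type} (E : Env S) (s : S) (b : Bool) : Env S :=
  open Classical in Function.update E s (some b)

/-- What the program level needs to know about a language of threads over the signal names `S`:
the free signal names of a thread, the small step reduction `(T, E) -[P]→ (T', E')`, where `P` is
the multiset of spawned threads, and the evaluation `⌊T⌋_E` at the end of the instant. It is only
used for the two languages `highLevel` and `tailRec` below. -/
structure Language (S : Type) where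
  Thr : Type 1
  names : Thr → List S
  step : Thr → Env S → Multiset Thr → Thr → Env S → Prop
  endInstant : Env S → Thr → Thr

section Programs

variable {S : Type} (L : Language S)

/-- One scheduling step `(P, E) → (P', E')` of a program. -/
inductive ProgStep : Multiset L.Thr × Env S → Multiset L.Thr × Env S → Prop
  | mk {P : Multiset L.Thr} {T T' : L.Thr} {E E' : Env S} {P'' : Multiset L.Thr}
      (h : L.step T E P'' T' E') : ProgStep (P + {T}, E) (P + {T'} + P'', E')

/-- `(P, E)↓`: no thread of `P` can be reduced in `E`. -/
def Suspended (P : Multiset L.Thr) (E : Env S) : Prop :=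
  ∀ T ∈ P, ∀ P'' T' E', ¬ L.step T E P'' T' E'

/-- `sig(P)`. -/
def sigProg (P : Multiset L.Thr) : Set S := {s | ∃ T ∈ P, s ∈ L.names T}

/-- The environment `E_{I,P}` at the beginning of an instant. -/
noncomputable def initEnv (Input Output I : Set S) (P : Multiset L.Thr) : Env S := fun s =>
  open Classical in
  if s ∈ I then some true
  else if s ∈ Input ∪ Output ∪ sigProg L P then some false
  else none

/-- The transition `P -[I/O]→ P'` of one instant; the label is the pair `(I, O)`. -/
def IOStep (Input Output : Set S) (P : Multiset L.Thr) (a : Set S × Set S)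
    (P' : Multiset L.Thr) : Prop :=
  a.1 ⊆ Input ∧ ∃ (Q : Multiset L.Thr) (E' : Env S),
    Relation.ReflTransGen (ProgStep L) (P, initEnv L Input Output a.1 P) (Q, E') ∧
    Suspended L Q E' ∧
    a.2 = {s | s ∈ Output ∧ E' s = some true} ∧
    P' = Q.map (L.endInstant E')

end Programs

/-- Finite or infinite words. -/
inductive Word (α : Type) : Type
  | finite (w : List α) : Word α
  | infinite (w : ℕ → α) : Word α

/-- Finite runs `P -[I₁/O₁]→ P₁ ⋯ -[Iₙ/Oₙ]→ Pₙ`. -/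
inductive Run {S : Type} (L : Language S) (Input Output : Set S) :
    Multiset L.Thr → List (Set S × Set S) → Multiset L.Thr → Prop
  | nil (P : Multiset L.Thr) : Run L Input Output P [] P
  | cons {P Q R : Multiset L.Thr} {a : Set S × Set S} {w : List (Set S × Set S)}
      (h : IOStep L Input Output P a Q) (hw : Run L Input Output Q w R) :
      Run L Input Output P (a :: w) R

/-- `tr(P)`: the words of the complete runs of `P`, that is of the infinite runs and of the finite
runs that cannot be extended. -/
def tr {S : Type} (L : Language S) (Input Output : Set S) (P : Multiset L.Thr) :
    Set (Word (Set S × Set S)) :=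
  {x | match x with
    | Word.finite w => ∃ Q, Run L Input Output P w Q ∧ ∀ a R, ¬ IOStep L Input Output Q a R
    | Word.infinite w => ∃ Q : ℕ → Multiset L.Thr,
        Q 0 = P ∧ ∀ n, IOStep L Input Output (Q n) (w n) (Q (n + 1))}

/-! ### The high level language -/

/-- Threads with free signal names in `V`, up to renaming of bound names: the body of `ν` is a
thread over `Option V`, in which `none` is the bound name. `Id n` is the type of thread identifiers
with `n` parameters. -/
inductive Thread (Id : ℕ → Type) : Type → Type 1
  | zero {V : Type} : Thread Id V
  | seq {V : Type} (T₁ T₂ : Thread Id V) : Thread Id V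
  | emit {V : Type} (s : V) : Thread Id V
  | nu {V : Type} (T : Thread Id (Option V)) : Thread Id V
  | spawn {V : Type} (T : Thread Id V) : Thread Id V
  | await {V : Type} (s : V) : Thread Id V
  | watch {V : Type} (s : V) (T : Thread Id V) : Thread Id V
  | call {V : Type} {n : ℕ} (A : Id n) (args : Fin n → V) : Thread Id V

namespace Thread

variable {Id : ℕ → Type}

/-- Substitution of signal names. -/
def map : {V W : Type} → (V → W) → Thread Id V → Thread Id W
  | _, _, _, zero => zero
  | _, _, f, seq T₁ T₂ => seq (map f T₁) (map f T₂)
  | _, _, f, emit s => emit (f s)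
  | _, _, f, nu T => nu (map (Option.map f) T)
  | _, _, f, spawn T => spawn (map f T)
  | _, _, f, await s => await (f s)
  | _, _, f, watch s T => watch (f s) (map f T)
  | _, _, f, call A args => call A (f ∘ args)

/-- The free signal names of a thread, listed with repetitions. -/
def names : {V : Type} → Thread Id V → List V
  | _, zero => []
  | _, seq T₁ T₂ => names T₁ ++ names T₂
  | _, emit s => [s]
  | _, nu T => (names T).reduceOption
  | _, spawn T => names T
  | _, await s => [s]
  | _, watch s T => s :: names T
  | _, call _ args => List.ofFn args

/-- Reduction of redexes. The equation of an identifier `A` with `n` parameters is `eqn n A`, a thread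
whose free names are the `n` parameters. In the rule for `ν` the bound name is renamed to any name
that is not in the domain of the environment. -/
inductive RedexStep {S : Type} (eqn : (n : ℕ) → Id n → Thread Id (Fin n)) :
    Thread Id S → Env S → Multiset (Thread Id S) → Thread Id S → Env S → Prop
  | zero_seq (T : Thread Id S) (E : Env S) : RedexStep eqn (seq zero T) E 0 T E
  | emit (s : S) (E : Env S) : RedexStep eqn (emit s) E 0 zero (E.set s true)
  | watch_zero (s : S) (E : Env S) : RedexStep eqn (watch s zero) E 0 zero E
  | nu (T : Thread Id (Option S)) (s : S) (E : Env S) (hs : E s = none) :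
      RedexStep eqn (nu T) E 0 (map (fun o => o.getD s) T) (E.set s false)
  | call {n : ℕ} (A : Id n) (args : Fin n → S) (E : Env S) :
      RedexStep eqn (call A args) E 0 (map args (eqn n A)) E
  | await (s : S) (E : Env S) (hs : E s = some true) : RedexStep eqn (await s) E 0 zero E
  | spawn (T : Thread Id S) (E : Env S) : RedexStep eqn (spawn T) E {T} zero E

/-- Evaluation contexts. Sequential composition is read up to associativity (it "associates to the
right"): on the syntax trees used here, where it may be nested to the left, this means that the
hole may stand under any number of left components of `;`. -/
inductive Ctx (Id : ℕ → Type) (S : Type) : Type 1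
  | hole : Ctx Id S
  | seq (C : Ctx Id S) (T : Thread Id S) : Ctx Id S
  | watch (s : S) (C : Ctx Id S) : Ctx Id S

/-- `C[T]`. -/
def Ctx.plug {S : Type} : Ctx Id S → Thread Id S → Thread Id S
  | .hole, T => T
  | .seq C U, T => Thread.seq (C.plug T) U
  | .watch s C, T => Thread.watch s (C.plug T)

/-- Reduction of threads. -/
inductive Step {S : Type} (eqn : (n : ℕ) → Id n → Thread Id (Fin n)) :
    Thread Id S → Env S → Multiset (Thread Id S) → Thread Id S → Env S → Prop
  | ctx (C : Ctx Id S) {D T' : Thread Id S} {E E' : Env S} {P : Multiset (Thread Id S)}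
      (h : RedexStep eqn D E P T' E') : Step eqn (C.plug D) E P (C.plug T') E'

/-- `⌊T⌋_E`. It is only meant for suspended threads; on all the other forms it is the identity. -/
def endInstant {S : Type} (E : Env S) : Thread Id S → Thread Id S
  | seq T T' => seq (endInstant E T) T'
  | watch s T => if E s = some true then zero else watch s (endInstant E T)
  | T => T

end Thread

/-- The high level language with the system of equations `eqn`. -/
abbrev highLevel {Id : ℕ → Type} (S : Type) (eqn : (n : ℕ) → Id n → Thread Id (Fin n)) :
    Language S where
  Thr := Thread Id S
  names := Thread.names
  step := Thread.Step eqn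
  endInstant := Thread.endInstant

/-! ### Tail recursive threads -/

mutual

/-- Tail recursive threads `t`, with the same conventions on names and identifiers as above. -/
inductive Tail (I : ℕ → Type 1) : Type → Type 1
  | zero {V : Type} : Tail I V
  | call {V : Type} {n : ℕ} (A : I n) (args : Fin n → V) : Tail I V
  | emit {V : Type} (s : V) (t : Tail I V) : Tail I V
  | nu {V : Type} (t : Tail I (Option V)) : Tail I V
  | spawn {V : Type} (t' t : Tail I V) : Tail I V
  | present {V : Type} (s : V) (t : Tail I V) (b : Branch I V) : Tail I V

/-- Branching threads `b`. -/
inductive Branch (I : ℕ → Type 1) : Type → Type 1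
  | ret {V : Type} (t : Tail I V) : Branch I V
  | ite {V : Type} (s : V) (b₁ b₂ : Branch I V) : Branch I V

/-- Sequences `τ = (s₁,t₁)⋯(sₙ,tₙ)`, extended on the right: `snoc τ s t` is `τ·(s,t)`. -/
inductive Handlers (I : ℕ → Type 1) : Type → Type 1
  | nil {V : Type} : Handlers I V
  | snoc {V : Type} (τ : Handlers I V) (s : V) (t : Tail I V) : Handlers I V

end

section TailRec

variable {I : ℕ → Type 1}

mutual

/-- Substitution of signal names. -/
def Tail.map : {V W : Type} → (V → W) → Tail I V → Tail I W
  | _, _, _, .zero => .zero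
  | _, _, f, .call A args => .call A (f ∘ args)
  | _, _, f, .emit s t => .emit (f s) (t.map f)
  | _, _, f, .nu t => .nu (t.map (Option.map f))
  | _, _, f, .spawn t' t => .spawn (t'.map f) (t.map f)
  | _, _, f, .present s t b => .present (f s) (t.map f) (b.map f)

/-- Substitution of signal names. -/
def Branch.map : {V W : Type} → (V → W) → Branch I V → Branch I W
  | _, _, f, .ret t => .ret (t.map f)
  | _, _, f, .ite s b₁ b₂ => .ite (f s) (b₁.map f) (b₂.map f)

end

/-- Substitution of signal names. -/
def Handlers.map {V W : Type} (f : V → W) : Handlers I V → Handlers I W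
  | .nil => .nil
  | .snoc τ s t => .snoc (τ.map f) (f s) (t.map f)

mutual

/-- The free signal names, listed with repetitions. -/
def Tail.names : {V : Type} → Tail I V → List V
  | _, .zero => []
  | _, .call _ args => List.ofFn args
  | _, .emit s t => s :: t.names
  | _, .nu t => t.names.reduceOption
  | _, .spawn t' t => t'.names ++ t.names
  | _, .present s t b => s :: (t.names ++ b.names)

/-- The free signal names, listed with repetitions. -/
def Branch.names : {V : Type} → Branch I V → List V
  | _, .ret t => t.names
  | _, .ite s b₁ b₂ => s :: (b₁.names ++ b₂.names)

end

/-- The free signal names, listed with repetitions. -/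
def Handlers.names {V : Type} : Handlers I V → List V
  | .nil => []
  | .snoc τ s t => τ.names ++ s :: t.names

/-- Extension of a substitution, defined on the free names of `ν t`, to the free names of `t`. -/
def liftSubst {V W : Type} (l : List (Option V)) (f : ∀ v, v ∈ l.reduceOption → W) :
    ∀ o, o ∈ l → Option W
  | none, _ => none
  | some v, h => some (f v (List.reduceOption_mem_iff.2 h))

mutual

/-- Substitution of signal names, where the substitution is only defined on the free names. -/
def Tail.pmap : {V W : Type} → (t : Tail I V) → (∀ v, v ∈ t.names → W) → Tail I W
  | _, _, .zero, _ => .zero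
  | _, _, .call A args, f => .call A fun i => f (args i) (by rw [Tail.names]; simp [List.mem_ofFn])
  | _, _, .emit s t, f =>
      .emit (f s (by rw [Tail.names]; simp)) (t.pmap fun v h => f v (by rw [Tail.names]; simp [h]))
  | _, _, .nu t, f =>
      .nu (t.pmap (liftSubst t.names fun v h => f v (by rw [Tail.names]; exact h)))
  | _, _, .spawn t' t, f =>
      .spawn (t'.pmap fun v h => f v (by rw [Tail.names]; simp [h]))
        (t.pmap fun v h => f v (by rw [Tail.names]; simp [h]))
  | _, _, .present s t b, f =>
      .present (f s (by rw [Tail.names]; simp)) (t.pmap fun v h => f v (by rw [Tail.names]; simp [h]))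
        (b.pmap fun v h => f v (by rw [Tail.names]; simp [h]))

/-- Substitution of signal names, where the substitution is only defined on the free names. -/
def Branch.pmap : {V W : Type} → (b : Branch I V) → (∀ v, v ∈ b.names → W) → Branch I W
  | _, _, .ret t, f => .ret (t.pmap fun v h => f v (by rw [Branch.names]; simp [h]))
  | _, _, .ite s b₁ b₂, f =>
      .ite (f s (by rw [Branch.names]; simp)) (b₁.pmap fun v h => f v (by rw [Branch.names]; simp [h]))
        (b₂.pmap fun v h => f v (by rw [Branch.names]; simp [h]))

end

/-- Substitution of signal names, where the substitution is only defined on the free names. -/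
def Handlers.pmap {V W : Type} : (τ : Handlers I V) → (∀ v, v ∈ τ.names → W) → Handlers I W
  | .nil, _ => .nil
  | .snoc τ s t, f =>
      .snoc (τ.pmap fun v h => f v (by rw [Handlers.names]; simp [h]))
        (f s (by rw [Handlers.names]; simp)) (t.pmap fun v h => f v (by rw [Handlers.names]; simp [h]))

/-- Reduction of tail recursive threads, for the system of equations `eqn`. -/
inductive Tail.Step {S : Type} (eqn : (n : ℕ) → I n → Tail I (Fin n)) :
    Tail I S → Env S → Multiset (Tail I S) → Tail I S → Env S → Prop
  | emit (s : S) (t : Tail I S) (E : Env S) : Step eqn (.emit s t) E 0 t (E.set s true)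
  | nu (t : Tail I (Option S)) (s : S) (E : Env S) (hs : E s = none) :
      Step eqn (.nu t) E 0 (t.map fun o => o.getD s) (E.set s false)
  | call {n : ℕ} (A : I n) (args : Fin n → S) (E : Env S) :
      Step eqn (.call A args) E 0 ((eqn n A).map args) E
  | present (s : S) (t : Tail I S) (b : Branch I S) (E : Env S) (hs : E s = some true) :
      Step eqn (.present s t b) E 0 t E
  | spawn (t' t : Tail I S) (E : Env S) : Step eqn (.spawn t' t) E {t'} t E

/-- Evaluation of a branching thread. -/
def Branch.eval {S : Type} (E : Env S) : Branch I S → Tail I S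
  | .ret t => t
  | .ite s b₁ b₂ => if E s = some true then b₁.eval E else b₂.eval E

/-- `⌊t⌋_E`. It is only meant for suspended threads; on all the other forms it is the identity. -/
def Tail.endInstant {S : Type} (E : Env S) : Tail I S → Tail I S
  | .present _ _ b => b.eval E
  | t => t

/-- The language of tail recursive threads with the system of equations `eqn`. -/
abbrev tailRec (S : Type) (eqn : (n : ℕ) → I n → Tail I (Fin n)) : Language S where
  Thr := Tail I S
  names := Tail.names
  step := Tail.Step eqn
  endInstant := Tail.endInstant

/-- `ite s₁ t₁ (⋯ (ite sₙ tₙ b) ⋯)` for `τ = (s₁,t₁)⋯(sₙ,tₙ)`. -/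
def Handlers.branch {V : Type} : Handlers I V → Branch I V → Branch I V
  | .nil, b => b
  | .snoc τ s t, b => τ.branch (.ite s (.ret t) b)

open Classical in
/-- The position of (the first occurrence of) a member of a list. -/
noncomputable def pos {V : Type} (l : List V) (v : V) (h : v ∈ l) : Fin l.length :=
  ⟨l.idxOf v, List.idxOf_lt_length_iff.2 h⟩

end TailRec

/-! ### The CPS translation -/

/-- The identifiers of the translated system of equations. The index `(t, τ)` is taken up to the
choice of its free names, which become parameters: it is a pair over the names `Fin m`.
`cps A t τ` is the identifier `A^(t,τ)`, whose parameters are those of `A` followed by the free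
names of `(t, τ)`. `await s t τ` is the identifier `A` of the equation
`A = present s t (ite s₁ t₁ (⋯ (ite sₙ tₙ A) ⋯))` used in the translation of `await s`; its
parameters are the free names of `s`, `t` and `τ`. -/
inductive CpsId (Id : ℕ → Type) : ℕ → Type 1
  | cps {k m : ℕ} (A : Id k) (t : Tail (CpsId Id) (Fin m)) (τ : Handlers (CpsId Id) (Fin m)) :
      CpsId Id (k + m)
  | await {m : ℕ} (s : Fin m) (t : Tail (CpsId Id) (Fin m)) (τ : Handlers (CpsId Id) (Fin m)) :
      CpsId Id m

section Cps

variable {Id : ℕ → Type}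

/-- The free names of `(t, τ)`, listed without repetitions. -/
noncomputable def contNames {V : Type} (t : Tail (CpsId Id) V) (τ : Handlers (CpsId Id) V) :
    List V :=
  open Classical in (t.names ++ τ.names).dedup

/-- The free names of `s`, `t` and `τ`, listed without repetitions. -/
noncomputable def awaitNames {V : Type} (s : V) (t : Tail (CpsId Id) V)
    (τ : Handlers (CpsId Id) V) : List V :=
  open Classical in (s :: (t.names ++ τ.names)).dedup

/-- `A^(t,τ)(args, s')`, where `s'` lists the free names of `(t, τ)`. -/
noncomputable def cpsCall {V : Type} {k : ℕ} (A : Id k) (args : Fin k → V)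
    (t : Tail (CpsId Id) V) (τ : Handlers (CpsId Id) V) : Tail (CpsId Id) V :=
  .call
    (.cps A (t.pmap fun v h => pos (contNames t τ) v (by rw [contNames]; simp [h]))
      (τ.pmap fun v h => pos (contNames t τ) v (by rw [contNames]; simp [h])))
    (Fin.append args (contNames t τ).get)

/-- The call of the identifier of the equation used in the translation of `await s`. -/
noncomputable def awaitCall {V : Type} (s : V) (t : Tail (CpsId Id) V)
    (τ : Handlers (CpsId Id) V) : Tail (CpsId Id) V :=
  .call
    (.await (pos (awaitNames s t τ) s (by rw [awaitNames]; simp))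
      (t.pmap fun v h => pos (awaitNames s t τ) v (by rw [awaitNames]; simp [h]))
      (τ.pmap fun v h => pos (awaitNames s t τ) v (by rw [awaitNames]; simp [h])))
    (awaitNames s t τ).get

/-- The CPS translation `⟦T⟧(t, τ)`. -/
noncomputable def cps : {V : Type} → Thread Id V → Tail (CpsId Id) V → Handlers (CpsId Id) V →
    Tail (CpsId Id) V
  | _, .zero, t, _ => t
  | _, .seq T₁ T₂, t, τ => cps T₁ (cps T₂ t τ) τ
  | _, .emit s, t, _ => .emit s t
  | _, .nu T, t, τ => .nu (cps T (t.map some) (τ.map some))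
  | _, .spawn T, t, _ => .spawn (cps T .zero .nil) t
  | _, .watch s T, t, τ => cps T t (.snoc τ s t)
  | _, .await s, t, τ => .present s t (τ.branch (.ret (awaitCall s t τ)))
  | _, .call A args, t, τ => cpsCall A args t τ

/-- The translated system of equations: `A^(t,τ)(x, s') = ⟦T⟧(t, τ)` where `A(x) = T`, and
`A = present s t (ite s₁ t₁ (⋯ (ite sₙ tₙ A) ⋯))` for the identifiers that come from `await`. -/
noncomputable def cpsEqn (eqn : (n : ℕ) → Id n → Thread Id (Fin n)) :
    (n : ℕ) → CpsId Id n → Tail (CpsId Id) (Fin n)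
  | _, .cps (k := k) (m := m) A t τ =>
      cps ((eqn k A).map (Fin.castAdd m)) (t.map (Fin.natAdd k)) (τ.map (Fin.natAdd k))
  | _, .await s t τ => .present s t (τ.branch (.ret (.call (.await s t τ) id)))

/-- `⟦P⟧`. -/
noncomputable def cpsProg {S : Type} (P : Multiset (Thread Id S)) :
    Multiset (Tail (CpsId Id) S) :=
  P.map fun T => cps T .zero .nil

end Cps

end SL

namespace SL

/-! ### Substitution of signal names -/

section Substitution

variable {Id : ℕ → Type}

theorem Thread.map_map : ∀ {U V W : Type} (f : V → W) (g : U → V) (T : Thread Id U),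
    (T.map g).map f = T.map (f ∘ g)
  | _, _, _, _, _, .zero => rfl
  | _, _, _, f, g, .seq T₁ T₂ => by simp only [Thread.map, Thread.map_map f g]
  | _, _, _, _, _, .emit _ => rfl
  | _, _, _, f, g, .nu T => by
      simp only [Thread.map, Thread.map_map (Option.map f) (Option.map g), Option.map_comp_map]
  | _, _, _, f, g, .spawn T => by simp only [Thread.map, Thread.map_map f g]
  | _, _, _, _, _, .await _ => rfl
  | _, _, _, f, g, .watch s T => by simp only [Thread.map, Thread.map_map f g, Function.comp]
  | _, _, _, _, _, .call _ _ => rfl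

theorem Thread.map_id : ∀ {V : Type} (T : Thread Id V), T.map id = T
  | _, .zero => rfl
  | _, .seq T₁ T₂ => by simp only [Thread.map, Thread.map_id]
  | _, .emit _ => rfl
  | _, .nu T => by simp only [Thread.map, Option.map_id, Thread.map_id]
  | _, .spawn T => by simp only [Thread.map, Thread.map_id]
  | _, .await _ => rfl
  | _, .watch s T => by simp only [Thread.map, Thread.map_id, id]
  | _, .call _ _ => rfl

theorem reduceOption_map_map {V W : Type} (f : V → W) (l : List (Option V)) :
    (l.map (Option.map f)).reduceOption = l.reduceOption.map f := by
  induction l with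
  | nil => rfl
  | cons o l ih => cases o <;> simp [ih]

theorem Thread.names_map : ∀ {V W : Type} (f : V → W) (T : Thread Id V),
    (T.map f).names = T.names.map f
  | _, _, _, .zero => rfl
  | _, _, f, .seq T₁ T₂ => by
      simp only [Thread.map, Thread.names, Thread.names_map f, List.map_append]
  | _, _, _, .emit _ => rfl
  | _, _, f, .nu T => by
      simp only [Thread.map, Thread.names, Thread.names_map, reduceOption_map_map]
  | _, _, f, .spawn T => by simp only [Thread.map, Thread.names, Thread.names_map f]
  | _, _, _, .await _ => rfl
  | _, _, f, .watch s T => by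
      simp only [Thread.map, Thread.names, Thread.names_map f, List.map_cons]
  | _, _, f, .call _ args => by simp only [Thread.map, Thread.names, List.map_ofFn]

variable {I : ℕ → Type 1}

mutual

theorem Tail.map_map : ∀ {U V W : Type} (f : V → W) (g : U → V) (t : Tail I U),
    (t.map g).map f = t.map (f ∘ g)
  | _, _, _, _, _, .zero => by simp only [Tail.map]
  | _, _, _, _, _, .call _ _ => by simp only [Tail.map, Function.comp_assoc]
  | _, _, _, f, g, .emit s t => by simp only [Tail.map, Tail.map_map f g t, Function.comp]
  | _, _, _, f, g, .nu t => by
      simp only [Tail.map, Tail.map_map (Option.map f) (Option.map g) t, Option.map_comp_map]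
  | _, _, _, f, g, .spawn t' t => by
      simp only [Tail.map, Tail.map_map f g t, Tail.map_map f g t']
  | _, _, _, f, g, .present s t b => by
      simp only [Tail.map, Tail.map_map f g t, Branch.map_map f g b, Function.comp]

theorem Branch.map_map : ∀ {U V W : Type} (f : V → W) (g : U → V) (b : Branch I U),
    (b.map g).map f = b.map (f ∘ g)
  | _, _, _, f, g, .ret t => by simp only [Branch.map, Tail.map_map f g t]
  | _, _, _, f, g, .ite s b₁ b₂ => by
      simp only [Branch.map, Branch.map_map f g b₁, Branch.map_map f g b₂, Function.comp]

end

theorem Handlers.map_map {U V W : Type} (f : V → W) (g : U → V) :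
    ∀ τ : Handlers I U, (τ.map g).map f = τ.map (f ∘ g)
  | .nil => by simp only [Handlers.map]
  | .snoc τ s t => by
      simp only [Handlers.map, Handlers.map_map f g τ, Tail.map_map, Function.comp]

theorem Handlers.map_branch {V W : Type} (f : V → W) :
    ∀ (τ : Handlers I V) (b : Branch I V), (τ.branch b).map f = (τ.map f).branch (b.map f)
  | .nil, b => by simp only [Handlers.branch, Handlers.map]
  | .snoc τ s t, b => by
      simp only [Handlers.branch, Handlers.map, Handlers.map_branch f τ, Branch.map]

mutual

theorem Tail.names_map : ∀ {V W : Type} (f : V → W) (t : Tail I V),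
    (t.map f).names = t.names.map f
  | _, _, _, .zero => by simp only [Tail.map, Tail.names, List.map_nil]
  | _, _, _, .call _ _ => by simp only [Tail.map, Tail.names, List.map_ofFn]
  | _, _, f, .emit s t => by simp only [Tail.map, Tail.names, Tail.names_map f t, List.map_cons]
  | _, _, f, .nu t => by
      simp only [Tail.map, Tail.names, Tail.names_map (Option.map f) t, reduceOption_map_map]
  | _, _, f, .spawn t' t => by
      simp only [Tail.map, Tail.names, Tail.names_map f t, Tail.names_map f t', List.map_append]
  | _, _, f, .present s t b => by
      simp only [Tail.map, Tail.names, Tail.names_map f t, Branch.names_map f b, List.map_append,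
        List.map_cons]

theorem Branch.names_map : ∀ {V W : Type} (f : V → W) (b : Branch I V),
    (b.map f).names = b.names.map f
  | _, _, f, .ret t => by simp only [Branch.map, Branch.names, Tail.names_map f t]
  | _, _, f, .ite s b₁ b₂ => by
      simp only [Branch.map, Branch.names, Branch.names_map f b₁, Branch.names_map f b₂,
        List.map_append, List.map_cons]

end

theorem Handlers.names_map {V W : Type} (f : V → W) :
    ∀ τ : Handlers I V, (τ.map f).names = τ.names.map f
  | .nil => by simp only [Handlers.map, Handlers.names, List.map_nil]
  | .snoc τ s t => by
      simp only [Handlers.map, Handlers.names, Handlers.names_map f τ, Tail.names_map,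
        List.map_append, List.map_cons]

mutual

theorem Tail.map_congr : ∀ {V W : Type} {f g : V → W} (t : Tail I V),
    (∀ v ∈ t.names, f v = g v) → t.map f = t.map g
  | _, _, _, _, .zero, _ => by simp only [Tail.map]
  | _, _, _, _, .call _ args, h => by
      simp only [Tail.names, List.forall_mem_ofFn_iff] at h
      simp only [Tail.map, Tail.call.injEq, heq_eq_eq, true_and]
      exact funext h
  | _, _, f, g, .emit s t, h => by
      simp only [Tail.names, List.forall_mem_cons] at h
      simp only [Tail.map, h.1, Tail.map_congr t h.2]
  | _, _, f, g, .nu t, h => by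
      simp only [Tail.names, List.reduceOption_mem_iff] at h
      simp only [Tail.map]
      rw [Tail.map_congr t (f := Option.map f) (g := Option.map g)]
      rintro (_ | v) hv
      · rfl
      · simp [h v hv]
  | _, _, f, g, .spawn t' t, h => by
      simp only [Tail.names, List.forall_mem_append] at h
      simp only [Tail.map, Tail.map_congr t' h.1, Tail.map_congr t h.2]
  | _, _, f, g, .present s t b, h => by
      simp only [Tail.names, List.forall_mem_cons, List.forall_mem_append] at h
      simp only [Tail.map, h.1, Tail.map_congr t h.2.1, Branch.map_congr b h.2.2]

theorem Branch.map_congr : ∀ {V W : Type} {f g : V → W} (b : Branch I V),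
    (∀ v ∈ b.names, f v = g v) → b.map f = b.map g
  | _, _, _, _, .ret t, h => by
      simp only [Branch.names] at h
      simp only [Branch.map, Tail.map_congr t h]
  | _, _, f, g, .ite s b₁ b₂, h => by
      simp only [Branch.names, List.forall_mem_cons, List.forall_mem_append] at h
      simp only [Branch.map, h.1, Branch.map_congr b₁ h.2.1, Branch.map_congr b₂ h.2.2]

end

mutual

theorem Tail.map_pmap : ∀ {U V W : Type} (t : Tail I U) (f : ∀ v, v ∈ t.names → V) (g : V → W)
    (h : U → W), (∀ v hv, g (f v hv) = h v) → (t.pmap f).map g = t.map h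
  | _, _, _, .zero, _, _, _, _ => by simp only [Tail.map, Tail.pmap]
  | _, _, _, .call _ args, f, g, h, H => by
      simp only [Tail.map, Tail.pmap, Tail.call.injEq, heq_eq_eq, true_and]
      exact funext fun i => H _ _
  | _, _, _, .emit s t, f, g, h, H => by
      simp only [Tail.map, Tail.pmap, H]
      rw [Tail.map_pmap t _ g h fun v hv => H _ _]
  | _, _, _, .nu t, f, g, h, H => by
      simp only [Tail.map, Tail.pmap]
      rw [Tail.map_pmap t _ (Option.map g) (Option.map h)]
      rintro (_ | v) hv
      · rfl
      · simp [liftSubst, H]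
  | _, _, _, .spawn t' t, f, g, h, H => by
      simp only [Tail.map, Tail.pmap]
      rw [Tail.map_pmap t _ g h fun v hv => H _ _, Tail.map_pmap t' _ g h fun v hv => H _ _]
  | _, _, _, .present s t b, f, g, h, H => by
      simp only [Tail.map, Tail.pmap, H]
      rw [Tail.map_pmap t _ g h fun v hv => H _ _, Branch.map_pmap b _ g h fun v hv => H _ _]

theorem Branch.map_pmap : ∀ {U V W : Type} (b : Branch I U) (f : ∀ v, v ∈ b.names → V)
    (g : V → W) (h : U → W), (∀ v hv, g (f v hv) = h v) → (b.pmap f).map g = b.map h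
  | _, _, _, .ret t, f, g, h, H => by
      simp only [Branch.map, Branch.pmap]
      rw [Tail.map_pmap t _ g h fun v hv => H _ _]
  | _, _, _, .ite s b₁ b₂, f, g, h, H => by
      simp only [Branch.map, Branch.pmap, H]
      rw [Branch.map_pmap b₁ _ g h fun v hv => H _ _, Branch.map_pmap b₂ _ g h fun v hv => H _ _]

end

theorem Handlers.map_pmap {U V W : Type} (g : V → W) (h : U → W) :
    ∀ (τ : Handlers I U) (f : ∀ v, v ∈ τ.names → V), (∀ v hv, g (f v hv) = h v) →
      (τ.pmap f).map g = τ.map h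
  | .nil, _, _ => by simp only [Handlers.map, Handlers.pmap]
  | .snoc τ s t, f, H => by
      simp only [Handlers.map, Handlers.pmap, H]
      rw [Tail.map_pmap t _ g h fun v hv => H _ _, Handlers.map_pmap g h τ _ fun v hv => H _ _]

theorem get_pos {V : Type} (l : List V) (v : V) (h : v ∈ l) : l.get (pos l v h) = v := by
  classical
  simp only [pos, List.get_eq_getElem]
  convert List.getElem_idxOf (List.idxOf_lt_length_iff.2 h)

end Substitution

/-! ### Stacks and their translations -/

section Representation

variable {Id : ℕ → Type}

/-- What remains to be done by a thread, innermost first: `inl T` stands for the continuation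
`[ ]; T` and `inr s` for the enclosing `watch s [ ]`. -/
abbrev Stack (Id : ℕ → Type) (V : Type) : Type 1 := List (Thread Id V ⊕ V)

/-- Substitution of signal names. -/
def Stack.map {V W : Type} (f : V → W) (K : Stack Id V) : Stack Id W :=
  List.map (Sum.map (Thread.map f) f) K

/-- The free signal names of a stack. -/
def Stack.names {V : Type} : Stack Id V → List V
  | [] => []
  | .inl T :: K => T.names ++ Stack.names K
  | .inr s :: K => s :: Stack.names K

theorem Stack.map_map {U V W : Type} (f : V → W) (g : U → V) (K : Stack Id U) :
    (K.map g).map f = K.map (f ∘ g) := by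
  simp only [Stack.map, List.map_map]
  congr 1
  funext x
  cases x <;> simp [Thread.map_map]

theorem Stack.map_id {V : Type} (K : Stack Id V) : K.map id = K := by
  simp only [Stack.map]
  convert List.map_id K
  funext x
  cases x <;> simp [Thread.map_id]

theorem Stack.names_map {V W : Type} (f : V → W) :
    ∀ K : Stack Id V, (K.map f).names = K.names.map f
  | [] => rfl
  | .inl T :: K => by
      have := Stack.names_map f K
      simp only [Stack.map, List.map_cons, Sum.map_inl, Stack.names, List.map_append,
        Thread.names_map] at this ⊢
      rw [this]
  | .inr s :: K => by
      have := Stack.names_map f K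
      simp only [Stack.map, List.map_cons, Sum.map_inr, Stack.names] at this ⊢
      rw [this]

mutual

/-- `Represents K u`: the tail recursive thread `u` is a CPS translation of the stack `K`, up to the
choice of the indices `(t, τ)` of the identifiers in `u`, which need not be the ones chosen by `cps`
since a substitution may identify some of their free names. -/
inductive Represents : {V : Type} → Stack Id V → Tail (CpsId Id) V → Prop
  | nil {V : Type} : Represents ([] : Stack Id V) .zero
  | zero {V : Type} {K : Stack Id V} {u : Tail (CpsId Id) V} (h : Represents K u) :
      Represents (.inl .zero :: K) u
  | seq {V : Type} {K : Stack Id V} {T₁ T₂ : Thread Id V} {u : Tail (CpsId Id) V}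
      (h : Represents (.inl T₁ :: .inl T₂ :: K) u) : Represents (.inl (.seq T₁ T₂) :: K) u
  | watch {V : Type} {K : Stack Id V} {s : V} {T : Thread Id V} {u : Tail (CpsId Id) V}
      (h : Represents (.inl T :: .inr s :: K) u) : Represents (.inl (.watch s T) :: K) u
  | leave {V : Type} {K : Stack Id V} {s : V} {u : Tail (CpsId Id) V} (h : Represents K u) :
      Represents (.inr s :: K) u
  | emit {V : Type} {K : Stack Id V} {s : V} {u : Tail (CpsId Id) V} (h : Represents K u) :
      Represents (.inl (.emit s) :: K) (.emit s u)
  | nu {V : Type} {K : Stack Id V} {T : Thread Id (Option V)} {u : Tail (CpsId Id) (Option V)}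
      (h : Represents (.inl T :: K.map some) u) : Represents (.inl (.nu T) :: K) (.nu u)
  | spawn {V : Type} {K : Stack Id V} {T : Thread Id V} {u' u : Tail (CpsId Id) V}
      (h' : Represents [.inl T] u') (h : Represents K u) :
      Represents (.inl (.spawn T) :: K) (.spawn u' u)
  | present {V : Type} {K : Stack Id V} {s : V} {u : Tail (CpsId Id) V} {n : ℕ} {B : CpsId Id n}
      {args : Fin n → V} {τ : Handlers (CpsId Id) V} {b : Branch (CpsId Id) V}
      (h : Represents K u) (hτ : RepresentsHandlers K τ)
      (hB : Represents (.inl (.await s) :: K) (.call B args))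
      (hb : b = τ.branch (.ret (.call B args))) :
      Represents (.inl (.await s) :: K) (.present s u b)
  | awaitCall {V : Type} {K : Stack Id V} {v : V} {m : ℕ} {s : Fin m}
      {t : Tail (CpsId Id) (Fin m)} {τ : Handlers (CpsId Id) (Fin m)} {args : Fin m → V}
      (hs : args s = v) (h : Represents K (t.map args)) (hτ : RepresentsHandlers K (τ.map args))
      (hargs : ∀ i, args i = v ∨ args i ∈ K.names) :
      Represents (.inl (.await v) :: K) (.call (.await s t τ) args)
  | cpsCall {V : Type} {K : Stack Id V} {k m : ℕ} {A : Id k} {a : Fin k → V}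
      {t : Tail (CpsId Id) (Fin m)} {τ : Handlers (CpsId Id) (Fin m)} {args : Fin (k + m) → V}
      (ha : args ∘ Fin.castAdd m = a) (h : Represents K (t.map (args ∘ Fin.natAdd k)))
      (hτ : RepresentsHandlers K (τ.map (args ∘ Fin.natAdd k)))
      (hargs : ∀ i, args (Fin.natAdd k i) ∈ K.names) :
      Represents (.inl (.call A a) :: K) (.call (.cps A t τ) args)

/-- `RepresentsHandlers K τ`: the sequence `τ` lists the enclosing `watch`es of the stack `K`,
together with CPS translations of the stacks they lead to. -/
inductive RepresentsHandlers : {V : Type} → Stack Id V → Handlers (CpsId Id) V → Prop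
  | nil {V : Type} : RepresentsHandlers ([] : Stack Id V) .nil
  | skip {V : Type} {K : Stack Id V} {T : Thread Id V} {τ : Handlers (CpsId Id) V}
      (h : RepresentsHandlers K τ) : RepresentsHandlers (.inl T :: K) τ
  | snoc {V : Type} {K : Stack Id V} {s : V} {τ : Handlers (CpsId Id) V} {t : Tail (CpsId Id) V}
      (h : RepresentsHandlers K τ) (ht : Represents K t) :
      RepresentsHandlers (.inr s :: K) (.snoc τ s t)

end

mutual

theorem Represents.map : ∀ {V W : Type} (f : V → W) {K : Stack Id V} {u : Tail (CpsId Id) V},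
    Represents K u → Represents (K.map f) (u.map f)
  | _, _, f, _, _, .nil => by rw [Tail.map]; exact .nil
  | _, _, f, _, _, .zero h => .zero (h.map f)
  | _, _, f, _, _, .seq h => .seq (h.map f)
  | _, _, f, _, _, .watch h => .watch (h.map f)
  | _, _, f, _, _, .leave h => .leave (h.map f)
  | _, _, f, _, _, .emit h => by rw [Tail.map]; exact .emit (h.map f)
  | _, _, f, _, _, .nu (K := K) h => by
      rw [Tail.map]
      refine .nu (T := Thread.map (Option.map f) _) ?_
      have := h.map (Option.map f)
      change Represents (Sum.inl _ :: Stack.map _ (Stack.map _ K)) _ at this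
      change Represents (_ :: Stack.map _ (Stack.map _ K)) _
      rw [Stack.map_map] at this ⊢
      exact this
  | _, _, f, _, _, .spawn h' h => by rw [Tail.map]; exact .spawn (h'.map f) (h.map f)
  | _, _, f, _, _, .present h hτ hB hb => by
      have := hB.map f
      simp only [Tail.map] at this ⊢
      refine .present (h.map f) (hτ.map f) this ?_
      rw [hb, Handlers.map_branch, Branch.map, Tail.map]
  | _, _, f, _, _, .awaitCall (K := K) hs h hτ hargs => by
      rw [Tail.map]
      refine .awaitCall (K := K.map f) (congrArg f hs) ?_ ?_ fun i => ?_
      · rw [← Tail.map_map]; exact h.map f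
      · rw [← Handlers.map_map]; exact hτ.map f
      · rw [Stack.names_map]
        exact (hargs i).imp (congrArg f) List.mem_map_of_mem
  | _, _, f, _, _, .cpsCall (K := K) ha h hτ hargs => by
      rw [Tail.map]
      refine .cpsCall (K := K.map f) (by rw [Function.comp_assoc, ha]) ?_ ?_ fun i => ?_
      · rw [Function.comp_assoc, ← Tail.map_map]; exact h.map f
      · rw [Function.comp_assoc, ← Handlers.map_map]; exact hτ.map f
      · rw [Stack.names_map]
        exact List.mem_map_of_mem (hargs i)

theorem RepresentsHandlers.map : ∀ {V W : Type} (f : V → W) {K : Stack Id V}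
    {τ : Handlers (CpsId Id) V}, RepresentsHandlers K τ → RepresentsHandlers (K.map f) (τ.map f)
  | _, _, f, _, _, .nil => by rw [Handlers.map]; exact .nil
  | _, _, f, _, _, .skip h => .skip (h.map f)
  | _, _, f, _, _, .snoc h ht => by rw [Handlers.map]; exact .snoc (h.map f) (ht.map f)

end

theorem mem_names_branch {I : ℕ → Type 1} {V : Type} {v : V} :
    ∀ {τ : Handlers I V} {b : Branch I V},
      v ∈ (τ.branch b).names → v ∈ τ.names ∨ v ∈ b.names
  | .nil, b, h => by rw [Handlers.branch] at h; exact .inr h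
  | .snoc τ s t, b, h => by
      rw [Handlers.branch] at h
      have := mem_names_branch h
      simp only [Branch.names, Handlers.names, List.mem_append, List.mem_cons] at this ⊢
      tauto

mutual

theorem Represents.names_subset : ∀ {V : Type} {K : Stack Id V} {u : Tail (CpsId Id) V},
    Represents K u → ∀ v ∈ u.names, v ∈ K.names
  | _, _, _, .nil, v, hv => by simp [Tail.names] at hv
  | _, _, _, .zero h, v, hv => h.names_subset v hv
  | _, _, _, .seq h, v, hv => by
      have := h.names_subset v hv
      simpa [Stack.names, Thread.names, or_assoc] using this
  | _, _, _, .watch h, v, hv => by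
      have := h.names_subset v hv
      simp only [Stack.names, Thread.names, List.mem_append, List.mem_cons] at this ⊢
      tauto
  | _, _, _, .leave h, v, hv => List.mem_cons_of_mem _ (h.names_subset v hv)
  | _, _, _, .emit h, v, hv => by
      have := h.names_subset v
      simp only [Tail.names, Stack.names, Thread.names, List.mem_append, List.mem_cons] at hv ⊢
      tauto
  | _, _, _, .nu (K := K) h, v, hv => by
      simp only [Tail.names, List.reduceOption_mem_iff] at hv
      have := h.names_subset _ hv
      change _ ∈ _ ++ (Stack.map some K).names at this
      rw [Stack.names_map] at this
      simpa [Stack.names, Thread.names, List.reduceOption_mem_iff] using this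
  | _, _, _, .spawn h' h, v, hv => by
      have := h.names_subset v
      have := h'.names_subset v
      simp only [Tail.names, Stack.names, Thread.names, List.mem_append, List.append_nil] at *
      tauto
  | _, _, _, .present h hτ hB hb, v, hv => by
      have h₁ := h.names_subset v
      have h₂ := hτ.names_subset v
      have h₃ := hB.names_subset v
      rw [hb] at hv
      simp only [Tail.names, Stack.names, Thread.names, List.mem_append, List.mem_cons] at *
      rcases hv with hv | hv | hv
      · exact .inl (.inl hv)
      · exact .inr (h₁ hv)
      · rcases mem_names_branch hv with hv | hv
        · exact .inr (h₂ hv)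
        · exact h₃ (by simpa only [Branch.names, Tail.names] using hv)
  | _, _, _, .awaitCall hs h hτ hargs, v, hv => by
      simp only [Tail.names, List.mem_ofFn] at hv
      obtain ⟨i, rfl⟩ := hv
      simpa [Stack.names, Thread.names] using hargs i
  | _, _, _, .cpsCall (k := k) ha h hτ hargs, v, hv => by
      simp only [Tail.names, List.mem_ofFn] at hv
      obtain ⟨i, rfl⟩ := hv
      simp only [Stack.names, Thread.names, List.mem_append, List.mem_ofFn, ← ha]
      induction i using Fin.addCases with
      | left i => exact .inl ⟨i, rfl⟩
      | right i => exact .inr (hargs i)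

theorem RepresentsHandlers.names_subset : ∀ {V : Type} {K : Stack Id V}
    {τ : Handlers (CpsId Id) V}, RepresentsHandlers K τ → ∀ v ∈ τ.names, v ∈ K.names
  | _, _, _, .nil, v, hv => by simp [Handlers.names] at hv
  | _, _, _, .skip h, v, hv => List.mem_append_right _ (h.names_subset v hv)
  | _, _, _, .snoc h ht, v, hv => by
      have h₁ := h.names_subset v
      have h₂ := ht.names_subset v
      simp only [Handlers.names, Stack.names, List.mem_append, List.mem_cons] at *
      tauto

end

/-- The CPS translation, followed by any substitution, represents the translated stack. -/
theorem represents_cps : ∀ {U V : Type} (f : U → V) (T : Thread Id U) {K : Stack Id V}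
    {t : Tail (CpsId Id) U} {τ : Handlers (CpsId Id) U}, Represents K (t.map f) →
    RepresentsHandlers K (τ.map f) → Represents (.inl (T.map f) :: K) ((cps T t τ).map f)
  | _, _, _, .zero, _, _, _, h, _ => by rw [cps]; exact .zero h
  | _, _, f, .seq T₁ T₂, _, _, _, h, hτ => by
      rw [cps]
      exact .seq (represents_cps f T₁ (represents_cps f T₂ h hτ) (.skip hτ))
  | _, _, _, .emit _, _, _, _, h, _ => by rw [cps, Tail.map]; exact .emit h
  | _, _, f, .nu T, K, t, τ, h, hτ => by
      rw [cps, Tail.map]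
      refine .nu (represents_cps (Option.map f) T ?_ ?_)
      · have := h.map some
        rw [Tail.map_map] at this ⊢
        exact this
      · have := hτ.map some
        rw [Handlers.map_map] at this ⊢
        exact this
  | _, _, f, .spawn T, _, _, _, h, _ => by
      rw [cps, Tail.map]
      refine .spawn (represents_cps f T ?_ ?_) h
      · rw [Tail.map]; exact .nil
      · rw [Handlers.map]; exact .nil
  | _, _, f, .watch s T, _, _, _, h, hτ => by
      rw [cps]
      refine .watch (represents_cps f T (.leave h) ?_)
      rw [Handlers.map]
      exact .snoc hτ h
  | _, _, f, .await s, K, t, τ, h, hτ => by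
      rw [cps, Tail.map, Handlers.map_branch, Branch.map, awaitCall, Tail.map]
      refine .present h hτ (.awaitCall ?_ ?_ ?_ fun i => ?_) rfl
      · simp only [Function.comp_apply, get_pos]
      · rw [Tail.map_pmap _ _ _ f]
        · exact h
        · exact fun v hv => congrArg f (get_pos _ _ _)
      · rw [Handlers.map_pmap _ f]
        · exact hτ
        · exact fun v hv => congrArg f (get_pos _ _ _)
      · have hi := List.get_mem (awaitNames s t τ) i
        simp only [awaitNames, List.mem_dedup, List.mem_cons, List.mem_append] at hi
        rcases hi with hi | hi | hi
        · exact .inl (congrArg f hi)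
        · exact .inr (h.names_subset _ (by rw [Tail.names_map]; exact List.mem_map_of_mem hi))
        · exact .inr (hτ.names_subset _ (by rw [Handlers.names_map]; exact List.mem_map_of_mem hi))
  | _, _, f, .call A args, K, t, τ, h, hτ => by
      rw [cps, cpsCall, Tail.map]
      refine .cpsCall ?_ ?_ ?_ fun i => ?_
      · funext i
        simp
      · rw [Tail.map_pmap _ _ _ f]
        · exact h
        · intro v hv
          simp only [Function.comp_apply, Fin.append_right, get_pos]
      · rw [Handlers.map_pmap _ f]
        · exact hτ
        · intro v hv
          simp only [Function.comp_apply, Fin.append_right, get_pos]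
      · have hi := List.get_mem (contNames t τ) i
        simp only [Function.comp_apply, Fin.append_right]
        simp only [contNames, List.mem_dedup, List.mem_append] at hi
        rcases hi with hi | hi
        · exact h.names_subset _ (by rw [Tail.names_map]; exact List.mem_map_of_mem hi)
        · exact hτ.names_subset _ (by rw [Handlers.names_map]; exact List.mem_map_of_mem hi)

end Representation

/-! ### The thread of a stack -/

section Stacks

variable {Id : ℕ → Type} {V : Type}

/-- The thread `T` in the evaluation context given by the stack. -/
def Stack.plug : Stack Id V → Thread Id V → Thread Id V
  | [], T => T
  | .inl U :: K, T => Stack.plug K (.seq T U)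
  | .inr s :: K, T => Stack.plug K (.watch s T)

/-- The thread that executes a stack. -/
def Stack.thread : Stack Id V → Thread Id V
  | [] => .zero
  | .inl T :: K => Stack.plug K T
  | .inr s :: K => Stack.plug K (.watch s .zero)

theorem Stack.plug_append (T : Thread Id V) (K' : Stack Id V) :
    ∀ K : Stack Id V, Stack.plug (K ++ K') T = Stack.plug K' (K.plug T) := by
  intro K
  induction K generalizing T with
  | nil => rfl
  | cons x K ih => cases x <;> exact ih _

theorem represents_plug_iff {K' : Stack Id V} {u : Tail (CpsId Id) V} {K : Stack Id V}
    {T : Thread Id V} :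
    Represents (.inl (K.plug T) :: K') u ↔ Represents (.inl T :: (K ++ K')) u := by
  induction K generalizing T with
  | nil => rfl
  | cons x K ih =>
    cases x with
    | inl U =>
      refine ih.trans ⟨fun h => ?_, .seq⟩
      cases h with
      | seq h => exact h
    | inr s =>
      refine ih.trans ⟨fun h => ?_, .watch⟩
      cases h with
      | watch h => exact h

theorem represents_singleton_plug_iff {u : Tail (CpsId Id) V} {K : Stack Id V}
    {T : Thread Id V} : Represents [.inl (K.plug T)] u ↔ Represents (.inl T :: K) u := by
  rw [represents_plug_iff, List.append_nil]

theorem Represents.thread {u : Tail (CpsId Id) V} :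
    ∀ {K : Stack Id V}, Represents K u → Represents [.inl K.thread] u
  | [], h => .zero h
  | .inl _ :: _, h => represents_singleton_plug_iff.2 h
  | .inr _ :: _, h => represents_singleton_plug_iff.2 (.watch (.zero h))

theorem Stack.exists_plug_eq_ctx_plug :
    ∀ K : Stack Id V, ∃ C : Thread.Ctx Id V, ∀ T, K.plug T = C.plug T := by
  intro K
  induction K using List.reverseRecOn with
  | nil => exact ⟨.hole, fun T => rfl⟩
  | append_singleton K x ih =>
    obtain ⟨C, hC⟩ := ih
    cases x with
    | inl U =>
      exact ⟨.seq C U, fun T => by simp [Stack.plug_append, Stack.plug, Thread.Ctx.plug, hC]⟩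
    | inr s =>
      exact ⟨.watch s C, fun T => by simp [Stack.plug_append, Stack.plug, Thread.Ctx.plug, hC]⟩

theorem Thread.Ctx.exists_plug_eq_stack_plug :
    ∀ C : Thread.Ctx Id V, ∃ K : Stack Id V, ∀ T, C.plug T = K.plug T
  | .hole => ⟨[], fun _ => rfl⟩
  | .seq C U => by
      obtain ⟨K, hK⟩ := C.exists_plug_eq_stack_plug
      exact ⟨K ++ [.inl U], fun T => by simp [Stack.plug_append, Stack.plug, Thread.Ctx.plug, hK]⟩
  | .watch s C => by
      obtain ⟨K, hK⟩ := C.exists_plug_eq_stack_plug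
      exact ⟨K ++ [.inr s], fun T => by simp [Stack.plug_append, Stack.plug, Thread.Ctx.plug, hK]⟩

variable {eqn : (n : ℕ) → Id n → Thread Id (Fin n)}

theorem Thread.RedexStep.plug {D T' : Thread Id V} {E E' : Env V} {P : Multiset (Thread Id V)}
    (h : Thread.RedexStep eqn D E P T' E') (K : Stack Id V) :
    Thread.Step eqn (K.plug D) E P (K.plug T') E' := by
  obtain ⟨C, hC⟩ := K.exists_plug_eq_ctx_plug
  rw [hC, hC]
  exact .ctx C h

theorem Thread.Step.exists_redex {T T' : Thread Id V} {E E' : Env V}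
    {P : Multiset (Thread Id V)} (h : Thread.Step eqn T E P T' E') :
    ∃ (K : Stack Id V) (D D' : Thread Id V), T = K.plug D ∧ T' = K.plug D' ∧
      Thread.RedexStep eqn D E P D' E' := by
  obtain ⟨C, h⟩ := h
  obtain ⟨K, hK⟩ := C.exists_plug_eq_stack_plug
  exact ⟨K, _, _, hK _, hK _, h⟩

/-- Steps that only remove a completed `0; [ ]` or `watch s 0`. -/
def Silent (eqn : (n : ℕ) → Id n → Thread Id (Fin n)) (T T' : Thread Id V) : Prop :=
  ∀ E : Env V, Thread.Step eqn T E 0 T' E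

theorem Stack.silent_plug_zero (eqn : (n : ℕ) → Id n → Thread Id (Fin n)) :
    ∀ K : Stack Id V, Relation.ReflTransGen (Silent eqn) (K.plug .zero) K.thread
  | [] => .refl
  | .inl T :: K => .single fun E => (Thread.RedexStep.zero_seq T E).plug K
  | .inr _ :: _ => .refl

/-- Stacks whose head is neither a completed thread nor a composed one. -/
def Stack.Normal : Stack Id V → Prop
  | [] => True
  | .inl .zero :: _ => False
  | .inl (.seq _ _) :: _ => False
  | .inl (.watch _ _) :: _ => False
  | .inl _ :: _ => True
  | .inr _ :: _ => False

theorem Represents.exists_normal (eqn : (n : ℕ) → Id n → Thread Id (Fin n)) :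
    ∀ {V : Type} {L : Stack Id V} {u : Tail (CpsId Id) V}, Represents L u →
      ∃ L' : Stack Id V, Relation.ReflTransGen (Silent eqn) L.thread L'.thread ∧
        Represents L' u ∧ L'.Normal
  | _, _, _, .nil => ⟨[], .refl, .nil, trivial⟩
  | _, _, _, .zero (K := K) h => by
      obtain ⟨L', h₁, h₂⟩ := h.exists_normal eqn
      exact ⟨L', (K.silent_plug_zero eqn).trans h₁, h₂⟩
  | _, _, _, .seq h => h.exists_normal eqn
  | _, _, _, .watch h => h.exists_normal eqn
  | _, _, _, .leave (K := K) (s := s) h => by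
      obtain ⟨L', h₁, h₂⟩ := h.exists_normal eqn
      refine ⟨L', .head (b := K.plug .zero) (fun E => ?_) ((K.silent_plug_zero eqn).trans h₁), h₂⟩
      exact (Thread.RedexStep.watch_zero s E).plug K
  | _, _, _, .emit h => ⟨_, .refl, .emit h, trivial⟩
  | _, _, _, .nu h => ⟨_, .refl, .nu h, trivial⟩
  | _, _, _, .spawn h' h => ⟨_, .refl, .spawn h' h, trivial⟩
  | _, _, _, .present h hτ hB hb => ⟨_, .refl, .present h hτ hB hb, trivial⟩
  | _, _, _, .awaitCall hs h hτ hargs => ⟨_, .refl, .awaitCall hs h hτ hargs, trivial⟩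
  | _, _, _, .cpsCall ha h hτ hargs => ⟨_, .refl, .cpsCall ha h hτ hargs, trivial⟩

/-! ### Suspended threads of the high level language -/

theorem Thread.not_step_zero {E E' : Env V} {P : Multiset (Thread Id V)} {T' : Thread Id V} :
    ¬ Thread.Step eqn .zero E P T' E' := by
  generalize hT : (Thread.zero : Thread Id V) = T
  rintro ⟨C, h⟩
  cases C with
  | hole =>
    rw [Thread.Ctx.plug] at hT
    subst hT
    cases h
  | seq C U => cases hT
  | watch s C => cases hT

theorem Thread.not_step_await {s : V} {E E' : Env V} (hs : E s ≠ some true)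
    {P : Multiset (Thread Id V)} {T' : Thread Id V} :
    ¬ Thread.Step eqn (.await s) E P T' E' := by
  generalize hT : (Thread.await s : Thread Id V) = T
  rintro ⟨C, h⟩
  cases C with
  | hole =>
    rw [Thread.Ctx.plug] at hT
    subst hT
    cases h
    contradiction
  | seq C U => cases hT
  | watch s C => cases hT

theorem Thread.Step.of_seq {T U T' : Thread Id V} {E E' : Env V} {P : Multiset (Thread Id V)}
    (h : Thread.Step eqn (.seq T U) E P T' E') :
    T = .zero ∨ ∃ T'', Thread.Step eqn T E P T'' E' := by
  generalize hT : (Thread.seq T U : Thread Id V) = X at h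
  obtain ⟨C, h⟩ := h
  cases C with
  | hole =>
    rw [Thread.Ctx.plug] at hT
    subst hT
    cases h
    exact .inl rfl
  | seq C U =>
    cases hT
    exact .inr ⟨_, .ctx C h⟩
  | watch s C => cases hT

theorem Thread.Step.of_watch {s : V} {T T' : Thread Id V} {E E' : Env V}
    {P : Multiset (Thread Id V)} (h : Thread.Step eqn (.watch s T) E P T' E') :
    T = .zero ∨ ∃ T'', Thread.Step eqn T E P T'' E' := by
  generalize hT : (Thread.watch s T : Thread Id V) = X at h
  obtain ⟨C, h⟩ := h
  cases C with
  | hole =>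
    rw [Thread.Ctx.plug] at hT
    subst hT
    cases h
    exact .inl rfl
  | seq C U => cases hT
  | watch s C =>
    cases hT
    exact .inr ⟨_, .ctx C h⟩

theorem Stack.not_step_plug {E : Env V} (K : Stack Id V) {T : Thread Id V} (h0 : T ≠ .zero)
    (h : ∀ P T' E', ¬ Thread.Step eqn T E P T' E') :
    ∀ P T' E', ¬ Thread.Step eqn (K.plug T) E P T' E' := by
  induction K generalizing T with
  | nil => exact h
  | cons x K ih =>
    cases x with
    | inl U =>
      refine ih (by simp) fun P T' E' hs => ?_
      rcases hs.of_seq with h' | ⟨T'', h'⟩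
      · exact h0 h'
      · exact h _ _ _ h'
    | inr s =>
      refine ih (by simp) fun P T' E' hs => ?_
      rcases hs.of_watch with h' | ⟨T'', h'⟩
      · exact h0 h'
      · exact h _ _ _ h'

end Stacks

/-! ### Inversion of substitutions -/

section Inversion

variable {I : ℕ → Type 1} {V W : Type} {f : V → W} {t : Tail I V}

theorem Tail.map_eq_zero (h : t.map f = .zero) : t = .zero := by
  cases t <;> simp [Tail.map] at h ⊢

theorem Tail.map_eq_emit {w : W} {u : Tail I W} (h : t.map f = .emit w u) :
    ∃ s t', t = .emit s t' ∧ f s = w ∧ t'.map f = u := by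
  cases t <;> simp_all [Tail.map]

theorem Tail.map_eq_nu {u : Tail I (Option W)} (h : t.map f = .nu u) :
    ∃ t', t = .nu t' ∧ t'.map (Option.map f) = u := by
  cases t <;> simp_all [Tail.map]

theorem Tail.map_eq_spawn {u' u : Tail I W} (h : t.map f = .spawn u' u) :
    ∃ t₁ t₂, t = .spawn t₁ t₂ ∧ t₁.map f = u' ∧ t₂.map f = u := by
  cases t <;> simp_all [Tail.map]

theorem Tail.map_eq_present {w : W} {u : Tail I W} {b : Branch I W}
    (h : t.map f = .present w u b) :
    ∃ s t' b', t = .present s t' b' ∧ f s = w ∧ t'.map f = u ∧ b'.map f = b := by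
  cases t <;> simp_all [Tail.map]

theorem Tail.map_eq_call {n : ℕ} {B : I n} {args : Fin n → W} (h : t.map f = .call B args) :
    ∃ args', t = .call B args' ∧ f ∘ args' = args := by
  cases t with
  | call A a =>
    rw [Tail.map] at h
    cases h
    exact ⟨a, rfl, rfl⟩
  | _ => simp [Tail.map] at h

end Inversion

/-! ### Simulation of the steps of a thread -/

section Threads

variable {S : Type} {Id : ℕ → Type}

theorem Env.set_self (E : Env S) (s : S) (b : Bool) : E.set s b s = some b := by
  simp [Env.set]

theorem Env.set_of_ne (E : Env S) {s s' : S} (h : s' ≠ s) (b : Bool) : E.set s b s' = E s' := by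
  simp [Env.set, h]

theorem Env.set_ne_none (E : Env S) {s s' : S} (b : Bool) (h : E s' ≠ none) :
    E.set s b s' ≠ none := by
  by_cases hs : s' = s
  · simp [hs, Env.set_self]
  · rwa [Env.set_of_ne E hs]

theorem Env.infinite_set {E : Env S} (h : {s | E s = none}.Infinite) (s : S) (b : Bool) :
    {s' | E.set s b s' = none}.Infinite := by
  refine (h.sdiff (Set.finite_singleton s)).mono ?_
  rintro s' ⟨hs', hne⟩
  exact (Env.set_of_ne E hne b).trans hs'

/-- The environment `F` is the environment `E`, up to the injective renaming `g` of the names in its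
domain, which contains `J`; the renaming is the identity on `J`. -/
structure EnvRel (J : Set S) (g : S → S) (E F : Env S) : Prop where
  eq : ∀ s, F s ≠ none → E (g s) = F s
  inj : Set.InjOn g {s | F s ≠ none}
  fixed : ∀ s ∈ J, g s = s
  dom : ∀ s ∈ J, F s ≠ none
  infinite_left : {s | E s = none}.Infinite
  infinite_right : {s | F s = none}.Infinite

/-- The renaming `g'` and the environment `F'` extend `g` and the domain of `F`. -/
def Extends (g : S → S) (F : Env S) (g' : S → S) (F' : Env S) : Prop :=
  ∀ s, F s ≠ none → F' s ≠ none ∧ g' s = g s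

theorem Extends.rfl {g : S → S} {F : Env S} : Extends g F g F := fun _ h => ⟨h, Eq.refl _⟩

variable {J : Set S} {g : S → S} {E F : Env S}

theorem EnvRel.set_true (h : EnvRel J g E F) {s : S} (hs : F s ≠ none) :
    EnvRel J g (E.set (g s) true) (F.set s true) where
  eq s' hs' := by
    by_cases hss : s' = s
    · rw [hss, Env.set_self, Env.set_self]
    · rw [Env.set_of_ne F hss] at hs' ⊢
      rw [Env.set_of_ne E fun hg => hss (h.inj hs' hs hg), h.eq s' hs']
  inj := by
    refine h.inj.mono fun s' hs' => ?_
    by_cases hss : s' = s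
    · rw [hss]; exact hs
    · simpa only [Set.mem_ofPred_eq, Env.set_of_ne F hss] using hs'
  fixed := h.fixed
  dom s' hs' := Env.set_ne_none F true (h.dom s' hs')
  infinite_left := Env.infinite_set h.infinite_left _ _
  infinite_right := Env.infinite_set h.infinite_right _ _

theorem Extends.set {s : S} {b : Bool} : Extends g F g (F.set s b) :=
  fun _ hs => ⟨Env.set_ne_none F b hs, Eq.refl _⟩

open Classical in
theorem EnvRel.set_fresh (h : EnvRel J g E F) {s s' : S} (hs : E s = none) (hs' : F s' = none) :
    EnvRel J (Function.update g s' s) (E.set s false) (F.set s' false) where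
  eq v hv := by
    by_cases hvs : v = s'
    · rw [hvs, Env.set_self, Function.update_self, Env.set_self]
    · rw [Env.set_of_ne F hvs] at hv ⊢
      rw [Function.update_of_ne hvs, Env.set_of_ne E, h.eq v hv]
      rintro hg
      exact hv (by rw [← h.eq v hv, hg, hs])
  inj v hv w hw hvw := by
    have key : ∀ x, x ≠ s' → F.set s' false x ≠ none → g x ≠ s := by
      intro x hxs hx hg
      rw [Env.set_of_ne F hxs] at hx
      exact hx (by rw [← h.eq x hx, hg, hs])
    simp only [Set.mem_ofPred_eq] at hv hw
    by_cases hvs : v = s' <;> by_cases hws : w = s'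
    · rw [hvs, hws]
    · subst hvs
      rw [Function.update_self, Function.update_of_ne hws] at hvw
      exact absurd hvw.symm (key w hws hw)
    · subst hws
      rw [Function.update_self, Function.update_of_ne hvs] at hvw
      exact absurd hvw (key v hvs hv)
    · rw [Function.update_of_ne hws, Function.update_of_ne hvs] at hvw
      rw [Env.set_of_ne F hvs] at hv
      rw [Env.set_of_ne F hws] at hw
      exact h.inj hv hw hvw
  fixed v hv := by
    rw [Function.update_of_ne, h.fixed v hv]
    rintro rfl
    exact h.dom _ hv hs'
  dom v hv := Env.set_ne_none F false (h.dom v hv)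
  infinite_left := Env.infinite_set h.infinite_left _ _
  infinite_right := Env.infinite_set h.infinite_right _ _

open Classical in
theorem Extends.set_fresh {s s' : S} (hs' : F s' = none) :
    Extends g F (Function.update g s' s) (F.set s' false) := by
  refine fun v hv => ⟨Env.set_ne_none F false hv, Function.update_of_ne ?_ _ _⟩
  rintro rfl
  exact hv hs'

/-- The thread `T` corresponds to the tail recursive thread `u`, whose names are in the domain of
`F`, up to the renaming `g`. -/
def Matches (g : S → S) (F : Env S) (T : Thread Id S) (u : Tail (CpsId Id) S) : Prop :=
  Represents [.inl T] (u.map g) ∧ ∀ s ∈ u.names, F s ≠ none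

theorem Matches.mono {g' : S → S} {F' : Env S} {T : Thread Id S} {u : Tail (CpsId Id) S}
    (h : Matches g F T u) (hext : Extends g F g' F') : Matches g' F' T u := by
  refine ⟨?_, fun s hs => (hext s (h.2 s hs)).1⟩
  rw [Tail.map_congr u fun s hs => (hext s (h.2 s hs)).2]
  exact h.1

theorem Tail.Step.names_dom {I : ℕ → Type 1} {eqn : (n : ℕ) → I n → Tail I (Fin n)}
    {u u' : Tail I S} {Q : Multiset (Tail I S)} {F F' : Env S} (h : Tail.Step eqn u F Q u' F')
    (hu : ∀ s ∈ u.names, F s ≠ none) :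
    (∀ s ∈ u'.names, F' s ≠ none) ∧ ∀ q ∈ Q, ∀ s ∈ q.names, F' s ≠ none := by
  cases h with
  | emit s t E =>
    simp only [Tail.names, List.forall_mem_cons] at hu
    exact ⟨fun v hv => Env.set_ne_none _ _ (hu.2 v hv), by simp⟩
  | nu t s E hs =>
    refine ⟨fun v hv => ?_, by simp⟩
    rw [Tail.names_map, List.mem_map] at hv
    obtain ⟨o, ho, rfl⟩ := hv
    cases o with
    | none => simp [Env.set_self]
    | some v =>
      exact Env.set_ne_none _ _ (hu v (by rwa [Tail.names, List.reduceOption_mem_iff]))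
  | call A args E =>
    refine ⟨fun v hv => ?_, by simp⟩
    rw [Tail.names_map, List.mem_map] at hv
    obtain ⟨i, -, rfl⟩ := hv
    exact hu _ (by rw [Tail.names, List.mem_ofFn]; exact ⟨i, rfl⟩)
  | present s t b E hs =>
    simp only [Tail.names, List.forall_mem_cons, List.forall_mem_append] at hu
    exact ⟨hu.2.1, by simp⟩
  | spawn t' t E =>
    simp only [Tail.names, List.forall_mem_append] at hu
    exact ⟨hu.2, by simpa using hu.1⟩

open Classical in
theorem Represents.nu_fresh {s s' : S} (hs' : F s' = none)
    {K : Stack Id S} {T : Thread Id (Option S)} {u : Tail (CpsId Id) (Option S)}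
    (hu : ∀ v ∈ (Tail.nu u).names, F v ≠ none)
    (hr : Represents (.inl T :: K.map some) (u.map (Option.map g))) :
    Represents (.inl (T.map fun o => o.getD s) :: K)
      ((u.map fun o => o.getD s').map (Function.update g s' s)) := by
  have := hr.map fun o => o.getD s
  change Represents (.inl _ :: (Stack.map some K).map _) _ at this
  rw [Stack.map_map, Tail.map_map] at this
  have hid : (fun o : Option S => o.getD s) ∘ some = id := rfl
  rw [hid, Stack.map_id] at this
  rw [Tail.map_map]
  convert this using 1
  refine Tail.map_congr u ?_
  rintro (_ | v) hv
  · simp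
  · have : F v ≠ none := hu v (by rwa [Tail.names, List.reduceOption_mem_iff])
    have hne : v ≠ s' := by rintro rfl; exact this hs'
    simp [hne]

variable {eqn : (n : ℕ) → Id n → Thread Id (Fin n)}

theorem Represents.unfold_cps {K : Stack Id S} {k m : ℕ} {A : Id k}
    {t : Tail (CpsId Id) (Fin m)} {τ : Handlers (CpsId Id) (Fin m)} {args : Fin (k + m) → S}
    (h : Represents K (t.map (args ∘ Fin.natAdd k)))
    (hτ : RepresentsHandlers K (τ.map (args ∘ Fin.natAdd k))) :
    Represents (.inl ((eqn k A).map (args ∘ Fin.castAdd m)) :: K)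
      ((cpsEqn eqn _ (.cps A t τ)).map args) := by
  rw [cpsEqn, ← Thread.map_map]
  refine represents_cps args _ ?_ ?_
  · rwa [Tail.map_map]
  · rwa [Handlers.map_map]

theorem map_cpsEqn_await {m : ℕ} {s : Fin m} {t : Tail (CpsId Id) (Fin m)}
    {τ : Handlers (CpsId Id) (Fin m)} {V : Type} (args : Fin m → V) :
    (cpsEqn eqn _ (.await s t τ)).map args = .present (args s) (t.map args)
      ((τ.map args).branch (.ret (.call (.await s t τ) args))) := by
  rw [cpsEqn, Tail.map, Handlers.map_branch, Branch.map, Tail.map]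
  rfl

theorem Represents.unfold_await {K : Stack Id S} {v : S} {m : ℕ} {s : Fin m}
    {t : Tail (CpsId Id) (Fin m)} {τ : Handlers (CpsId Id) (Fin m)} {args : Fin m → S}
    (hs : args s = v) (h : Represents K (t.map args)) (hτ : RepresentsHandlers K (τ.map args))
    (hargs : ∀ i, args i = v ∨ args i ∈ K.names) :
    Represents (.inl (.await v) :: K) ((cpsEqn eqn _ (.await s t τ)).map args) := by
  rw [map_cpsEqn_await, hs]
  exact .present h hτ (.awaitCall hs h hτ hargs) rfl

/-- The states reached by corresponding threads, together with the threads they spawned, correspond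
for an extended renaming. -/
def Evolves (J : Set S) (g : S → S) (F : Env S) (P : Multiset (Thread Id S)) (T : Thread Id S)
    (E' : Env S) (Q : Multiset (Tail (CpsId Id) S)) (u : Tail (CpsId Id) S) (F' : Env S) : Prop :=
  ∃ g', EnvRel J g' E' F' ∧ Extends g F g' F' ∧ Multiset.Rel (Matches g' F') P Q ∧
    Matches g' F' T u

/-- A thread of a program reduces in several steps. -/
def ThreadSteps (L : Language S) (T : L.Thr) (E : Env S) (P : Multiset L.Thr) (T' : L.Thr)
    (E' : Env S) : Prop :=
  ∀ R : Multiset L.Thr, Relation.ReflTransGen (ProgStep L) (R + {T}, E) (R + {T'} + P, E')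

theorem ThreadSteps.rfl {L : Language S} {T : L.Thr} {E : Env S} : ThreadSteps L T E 0 T E := by
  intro R
  rw [add_zero]

theorem ThreadSteps.head {L : Language S} {T T' T'' : L.Thr} {E E' E'' : Env S}
    {P : Multiset L.Thr} (h : L.step T E 0 T' E') (h' : ThreadSteps L T' E' P T'' E'') :
    ThreadSteps L T E P T'' E'' := by
  intro R
  refine .head (ProgStep.mk h) ?_
  rw [add_zero]
  exact h' R

theorem ThreadSteps.single {L : Language S} {T T' : L.Thr} {E E' : Env S}
    {P : Multiset L.Thr} (h : L.step T E P T' E') : ThreadSteps L T E P T' E' :=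
  fun _ => .single (ProgStep.mk h)

theorem ThreadSteps.of_silent {T T' T'' : Thread Id S} {E' : Env S}
    {P : Multiset (Thread Id S)} (h : Relation.ReflTransGen (Silent eqn) T T')
    (h' : ThreadSteps (highLevel S eqn) T' E P T'' E') :
    ThreadSteps (highLevel S eqn) T E P T'' E' := by
  induction h using Relation.ReflTransGen.head_induction_on with
  | refl => exact h'
  | head h₁ _ ih => exact .head (h₁ E) ih

theorem Matches.tail_simulates {T T' : Thread Id S} {u : Tail (CpsId Id) S} {E' : Env S}
    {P : Multiset (Thread Id S)} (hm : Matches g F T u) (hE : EnvRel J g E F)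
    (h : Thread.Step eqn T E P T' E') :
    ∃ Q u' F', ThreadSteps (tailRec S (cpsEqn eqn)) u F Q u' F' ∧
      Evolves J g F P T' E' Q u' F' := by
  obtain ⟨K, D, D', rfl, rfl, hredex⟩ := h.exists_redex
  obtain ⟨hr, hn⟩ := hm
  rw [represents_singleton_plug_iff] at hr
  clear h
  cases hredex with
  | zero_seq U =>
    cases hr with
    | seq hr =>
      cases hr with
      | zero hr =>
        exact ⟨0, u, F, .rfl, g, hE, .rfl, .zero, represents_singleton_plug_iff.2 hr, hn⟩
  | watch_zero s =>
    cases hr with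
    | watch hr =>
      cases hr with
      | zero hr =>
        cases hr with
        | leave hr =>
          exact ⟨0, u, F, .rfl, g, hE, .rfl, .zero, represents_singleton_plug_iff.2 (.zero hr), hn⟩
  | emit s =>
    generalize hw : u.map g = w at hr
    cases hr with
    | emit hr =>
      obtain ⟨s, u, rfl, rfl, rfl⟩ := Tail.map_eq_emit hw
      have hstep := Tail.Step.emit (eqn := cpsEqn eqn) s u F
      refine ⟨0, u, _, .single hstep, g, hE.set_true ?_, .set, .zero,
        represents_singleton_plug_iff.2 (.zero hr), (hstep.names_dom hn).1⟩
      exact hn s (by simp [Tail.names])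
  | nu U s E hs =>
    generalize hw : u.map g = w at hr
    cases hr with
    | nu hr =>
      obtain ⟨u, rfl, rfl⟩ := Tail.map_eq_nu hw
      obtain ⟨s', hs'⟩ := hE.infinite_right.nonempty
      have hstep := Tail.Step.nu (eqn := cpsEqn eqn) u s' F hs'
      exact ⟨0, _, _, .single hstep, _, hE.set_fresh hs hs', .set_fresh hs', .zero,
        represents_singleton_plug_iff.2 (hr.nu_fresh hs' hn), (hstep.names_dom hn).1⟩
  | call A a =>
    generalize hw : u.map g = w at hr
    cases hr with
    | @cpsCall _ _ _ _ _ _ t τ _ ha hr hτ hargs =>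
      obtain ⟨args, rfl, rfl⟩ := Tail.map_eq_call hw
      have hstep := Tail.Step.call (eqn := cpsEqn eqn) (.cps A t τ) args F
      refine ⟨0, _, _, .single hstep, g, hE, .rfl, .zero,
        represents_singleton_plug_iff.2 ?_, (hstep.names_dom hn).1⟩
      rw [Tail.map_map, ← ha]
      exact Represents.unfold_cps hr hτ
  | await s E hs =>
    generalize hw : u.map g = w at hr
    cases hr with
    | present hr hτ hB hb =>
      obtain ⟨s, u, b, rfl, rfl, rfl, -⟩ := Tail.map_eq_present hw
      rw [hE.eq s (hn s (by simp [Tail.names]))] at hs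
      have hstep := Tail.Step.present (eqn := cpsEqn eqn) s u b F hs
      exact ⟨0, _, _, .single hstep, g, hE, .rfl, .zero,
        represents_singleton_plug_iff.2 (.zero hr), (hstep.names_dom hn).1⟩
    | @awaitCall _ _ _ _ v t τ _ hv hr hτ hargs =>
      obtain ⟨args, rfl, rfl⟩ := Tail.map_eq_call hw
      have hstep := Tail.Step.call (eqn := cpsEqn eqn) (.await v t τ) args F
      have hn' := (hstep.names_dom hn).1
      rw [map_cpsEqn_await] at hstep hn'
      rw [← hv, Function.comp_apply, hE.eq _ (hn' _ (by simp [Tail.names]))] at hs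
      have hstep' := Tail.Step.present (eqn := cpsEqn eqn) _ (t.map args)
        ((τ.map args).branch (.ret (.call (.await v t τ) args))) F hs
      refine ⟨0, _, _, .head hstep (.single hstep'), g, hE, .rfl, .zero,
        represents_singleton_plug_iff.2 (.zero ?_), (hstep'.names_dom hn').1⟩
      rwa [Tail.map_map]
  | spawn U =>
    generalize hw : u.map g = w at hr
    cases hr with
    | spawn hr' hr =>
      obtain ⟨u', u, rfl, rfl, rfl⟩ := Tail.map_eq_spawn hw
      have hstep := Tail.Step.spawn (eqn := cpsEqn eqn) u' u F
      have hn' := hstep.names_dom hn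
      refine ⟨{u'}, _, _, .single hstep, g, hE, .rfl, ?_,
        represents_singleton_plug_iff.2 (.zero hr), hn'.1⟩
      exact Multiset.rel_cons_left.2 ⟨u', 0, ⟨hr', hn'.2 _ (by simp)⟩, .zero, rfl⟩

theorem Matches.thread_simulates {T : Thread Id S} {u u' : Tail (CpsId Id) S} {F' : Env S}
    {Q : Multiset (Tail (CpsId Id) S)} (hm : Matches g F T u) (hE : EnvRel J g E F)
    (h : Tail.Step (cpsEqn eqn) u F Q u' F') :
    ∃ P T' E', ThreadSteps (highLevel S eqn) T E P T' E' ∧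
      Evolves J g F P T' E' Q u' F' := by
  obtain ⟨hr, hn⟩ := hm
  obtain ⟨hn', hnQ⟩ := h.names_dom hn
  obtain ⟨L, hL, hr, hnormal⟩ := hr.exists_normal eqn
  generalize hw : u.map g = w at hr
  cases hr with
  | nil =>
    rw [Tail.map_eq_zero hw] at h
    cases h
  | zero | seq | watch | leave => exact hnormal.elim
  | @emit _ K s _ hr =>
    obtain ⟨s, u, rfl, rfl, rfl⟩ := Tail.map_eq_emit hw
    cases h
    exact ⟨0, _, _, .of_silent hL (.single ((Thread.RedexStep.emit _ E).plug K)), g,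
      hE.set_true (hn s (by simp [Tail.names])), .set, .zero,
      represents_singleton_plug_iff.2 (.zero hr), hn'⟩
  | @nu _ K U _ hr =>
    obtain ⟨u, rfl, rfl⟩ := Tail.map_eq_nu hw
    obtain ⟨s, hs⟩ := hE.infinite_left.nonempty
    cases h with
    | nu _ s' _ hs' =>
    exact ⟨0, _, _, .of_silent hL (.single ((Thread.RedexStep.nu U s E hs).plug K)), _,
      hE.set_fresh hs hs', .set_fresh hs', .zero,
      represents_singleton_plug_iff.2 (hr.nu_fresh hs' hn), hn'⟩
  | @spawn _ K U _ _ hr' hr =>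
    obtain ⟨u', u, rfl, rfl, rfl⟩ := Tail.map_eq_spawn hw
    cases h
    refine ⟨{U}, _, _, .of_silent hL (.single ((Thread.RedexStep.spawn U E).plug K)), g, hE, .rfl,
      ?_, represents_singleton_plug_iff.2 (.zero hr), hn'⟩
    exact Multiset.rel_cons_left.2 ⟨u', 0, ⟨hr', hnQ _ (by simp)⟩, .zero, rfl⟩
  | @present _ K _ _ _ _ _ _ _ hr hτ hB hb =>
    obtain ⟨s, u, b, rfl, rfl, rfl, -⟩ := Tail.map_eq_present hw
    cases h with
    | present _ _ _ _ hs =>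
    rw [← hE.eq s (hn s (by simp [Tail.names]))] at hs
    exact ⟨0, _, _, .of_silent hL (.single ((Thread.RedexStep.await _ E hs).plug K)), g, hE, .rfl,
      .zero, represents_singleton_plug_iff.2 (.zero hr), hn'⟩
  | awaitCall hv hr hτ hargs =>
    obtain ⟨args, rfl, rfl⟩ := Tail.map_eq_call hw
    cases h
    refine ⟨0, _, _, .of_silent hL .rfl, g, hE, .rfl, .zero, Represents.thread ?_, hn'⟩
    rw [Tail.map_map]
    exact Represents.unfold_await hv hr hτ hargs
  | @cpsCall _ K _ _ A a _ _ _ ha hr hτ hargs =>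
    obtain ⟨args, rfl, rfl⟩ := Tail.map_eq_call hw
    cases h
    refine ⟨0, _, _, .of_silent hL (.single ((Thread.RedexStep.call A a E).plug K)), g, hE, .rfl,
      .zero, represents_singleton_plug_iff.2 ?_, hn'⟩
    rw [Tail.map_map, ← ha]
    exact Represents.unfold_cps hr hτ

end Threads

/-! ### Simulation of programs -/

section Programs

variable {S : Type} {Id : ℕ → Type} {J : Set S} {g : S → S} {E F : Env S}
  {eqn : (n : ℕ) → Id n → Thread Id (Fin n)}

/-- Corresponding configurations of the two languages. -/
def ConfigRel (J : Set S) (p : Multiset (Thread Id S) × Env S)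
    (q : Multiset (Tail (CpsId Id) S) × Env S) : Prop :=
  ∃ g, EnvRel J g p.2 q.2 ∧ Multiset.Rel (Matches g q.2) p.1 q.1

theorem Evolves.configRel {P₀ P : Multiset (Thread Id S)} {Q₀ Q : Multiset (Tail (CpsId Id) S)}
    {T : Thread Id S} {u : Tail (CpsId Id) S} {E' F' : Env S} (h : Evolves J g F P T E' Q u F')
    (h₀ : Multiset.Rel (Matches g F) P₀ Q₀) :
    ConfigRel J (P₀ + {T} + P, E') (Q₀ + {u} + Q, F') := by
  obtain ⟨g', hE, hext, hPQ, hm⟩ := h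
  refine ⟨g', hE, .add (.add (h₀.mono fun _ _ _ _ h => h.mono hext) ?_) hPQ⟩
  exact Multiset.rel_cons_left.2 ⟨u, 0, hm, .zero, rfl⟩

theorem rel_add_singleton_left {α β : Type*} {r : α → β → Prop} {P : Multiset α} {a : α}
    {Q : Multiset β} (h : Multiset.Rel r (P + {a}) Q) :
    ∃ Q' b, Multiset.Rel r P Q' ∧ r a b ∧ Q = Q' + {b} := by
  rw [add_comm, Multiset.singleton_add, Multiset.rel_cons_left] at h
  obtain ⟨b, Q', hab, hPQ, rfl⟩ := h
  exact ⟨Q', b, hPQ, hab, by rw [add_comm, Multiset.singleton_add]⟩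

theorem ConfigRel.tail_simulates_step {p p' : Multiset (Thread Id S) × Env S}
    {q : Multiset (Tail (CpsId Id) S) × Env S} (h : ConfigRel J p q)
    (hp : ProgStep (highLevel S eqn) p p') :
    ∃ q', Relation.ReflTransGen (ProgStep (tailRec S (cpsEqn eqn))) q q' ∧ ConfigRel J p' q' := by
  obtain ⟨hstep⟩ := hp
  obtain ⟨Q, F⟩ := q
  obtain ⟨g, hE, hPQ⟩ := h
  obtain ⟨Q', u, hPQ, hm, rfl⟩ := rel_add_singleton_left hPQ
  obtain ⟨Q'', u', F', hs, hev⟩ := hm.tail_simulates hE hstep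
  exact ⟨_, hs Q', hev.configRel hPQ⟩

theorem ConfigRel.thread_simulates_step {p : Multiset (Thread Id S) × Env S}
    {q q' : Multiset (Tail (CpsId Id) S) × Env S} (h : ConfigRel J p q)
    (hq : ProgStep (tailRec S (cpsEqn eqn)) q q') :
    ∃ p', Relation.ReflTransGen (ProgStep (highLevel S eqn)) p p' ∧ ConfigRel J p' q' := by
  obtain ⟨hstep⟩ := hq
  obtain ⟨P, E⟩ := p
  obtain ⟨g, hE, hPQ⟩ := h
  obtain ⟨P', T, hPQ', hm, rfl⟩ := rel_add_singleton_left (Multiset.rel_flip.2 hPQ)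
  obtain ⟨P'', T', E', hs, hev⟩ := hm.thread_simulates hE hstep
  exact ⟨_, hs P', hev.configRel (Multiset.rel_flip.1 hPQ')⟩

theorem ConfigRel.tail_simulates {p p' : Multiset (Thread Id S) × Env S}
    {q : Multiset (Tail (CpsId Id) S) × Env S} (h : ConfigRel J p q)
    (hp : Relation.ReflTransGen (ProgStep (highLevel S eqn)) p p') :
    ∃ q', Relation.ReflTransGen (ProgStep (tailRec S (cpsEqn eqn))) q q' ∧ ConfigRel J p' q' := by
  induction hp with
  | refl => exact ⟨q, .refl, h⟩
  | tail _ hstep ih =>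
    obtain ⟨q₁, h₁, hr⟩ := ih
    obtain ⟨q₂, h₂, hr⟩ := hr.tail_simulates_step hstep
    exact ⟨q₂, h₁.trans h₂, hr⟩

theorem ConfigRel.thread_simulates {p : Multiset (Thread Id S) × Env S}
    {q q' : Multiset (Tail (CpsId Id) S) × Env S} (h : ConfigRel J p q)
    (hq : Relation.ReflTransGen (ProgStep (tailRec S (cpsEqn eqn))) q q') :
    ∃ p', Relation.ReflTransGen (ProgStep (highLevel S eqn)) p p' ∧ ConfigRel J p' q' := by
  induction hq with
  | refl => exact ⟨p, .refl, h⟩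
  | tail _ hstep ih =>
    obtain ⟨p₁, h₁, hr⟩ := ih
    obtain ⟨p₂, h₂, hr⟩ := hr.thread_simulates_step hstep
    exact ⟨p₂, h₁.trans h₂, hr⟩

/-! ### The end of the instant -/

/-- The thread `T` cannot be reduced in `E`. -/
def Irreducible (L : Language S) (E : Env S) (T : L.Thr) : Prop :=
  ∀ P T' E', ¬ L.step T E P T' E'

theorem Irreducible.eq_of_silent {T T' : Thread Id S} (hT : Irreducible (highLevel S eqn) E T)
    (h : Relation.ReflTransGen (Silent eqn) T T') : T' = T := by
  rcases h.cases_head with rfl | ⟨T'', h, -⟩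
  · rfl
  · exact absurd (h E) (hT _ _ _)

theorem irreducible_plug_await {s : S} (hs : E s ≠ some true) (K : Stack Id S) :
    Irreducible (highLevel S eqn) E (K.plug (.await s)) :=
  K.not_step_plug (by simp) fun _ _ _ => Thread.not_step_await hs

theorem Matches.exists_irreducible_tail {T : Thread Id S} {u : Tail (CpsId Id) S}
    (hm : Matches g F T u) (hE : EnvRel J g E F) (hT : Irreducible (highLevel S eqn) E T) :
    ∃ u', ThreadSteps (tailRec S (cpsEqn eqn)) u F 0 u' F ∧ Matches g F T u' ∧
      Irreducible (tailRec S (cpsEqn eqn)) F u' := by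
  have hn := hm.2
  obtain ⟨L, hL, hr, hnormal⟩ := hm.1.exists_normal eqn
  obtain rfl := hT.eq_of_silent hL
  generalize hw : u.map g = w at hr
  cases hr with
  | nil =>
    refine ⟨u, .rfl, hm, fun _ _ _ h => ?_⟩
    rw [Tail.map_eq_zero hw] at h
    cases h
  | zero | seq | watch | leave => exact hnormal.elim
  | @emit _ K s _ hr => exact absurd ((Thread.RedexStep.emit s E).plug K) (hT _ _ _)
  | @nu _ K U _ hr =>
    obtain ⟨s, hs⟩ := hE.infinite_left.nonempty
    exact absurd ((Thread.RedexStep.nu U s E hs).plug K) (hT _ _ _)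
  | @spawn _ K U _ _ hr' hr => exact absurd ((Thread.RedexStep.spawn U E).plug K) (hT _ _ _)
  | @present _ K _ _ _ _ _ _ _ hr hτ hB hb =>
    obtain ⟨s, u, b, rfl, rfl, rfl, -⟩ := Tail.map_eq_present hw
    refine ⟨_, .rfl, hm, fun _ _ _ h => ?_⟩
    cases h with
    | present _ _ _ _ hs =>
    rw [← hE.eq s (hn s (by simp [Tail.names]))] at hs
    exact absurd ((Thread.RedexStep.await _ E hs).plug K) (hT _ _ _)
  | @awaitCall _ K _ _ v t τ _ hv hr hτ hargs =>
    obtain ⟨args, rfl, rfl⟩ := Tail.map_eq_call hw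
    have hstep := Tail.Step.call (eqn := cpsEqn eqn) (.await v t τ) args F
    have hn' := (hstep.names_dom hn).1
    refine ⟨_, .single hstep, ⟨Represents.thread ?_, hn'⟩, fun _ _ _ h => ?_⟩
    · rw [Tail.map_map]
      exact Represents.unfold_await hv hr hτ hargs
    · rw [map_cpsEqn_await] at h hn'
      cases h with
      | present _ _ _ _ hs =>
      rw [← hE.eq _ (hn' _ (by simp [Tail.names])), ← Function.comp_apply (f := g), hv] at hs
      exact absurd ((Thread.RedexStep.await _ E hs).plug K) (hT _ _ _)
  | @cpsCall _ K _ _ A a _ _ _ ha hr hτ hargs =>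
    exact absurd ((Thread.RedexStep.call A a E).plug K) (hT _ _ _)

theorem Matches.exists_irreducible_thread {T : Thread Id S} {u : Tail (CpsId Id) S}
    (hm : Matches g F T u) (hE : EnvRel J g E F)
    (hu : Irreducible (tailRec S (cpsEqn eqn)) F u) :
    ∃ T', ThreadSteps (highLevel S eqn) T E 0 T' E ∧ Matches g F T' u ∧
      Irreducible (highLevel S eqn) E T' := by
  have hn := hm.2
  obtain ⟨L, hL, hr, hnormal⟩ := hm.1.exists_normal eqn
  refine ⟨L.thread, .of_silent hL .rfl, ⟨hr.thread, hn⟩, ?_⟩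
  clear hL
  generalize hw : u.map g = w at hr
  cases hr with
  | nil => exact fun _ _ _ => Thread.not_step_zero
  | zero | seq | watch | leave => exact hnormal.elim
  | emit hr =>
    obtain ⟨s, u, rfl, rfl, rfl⟩ := Tail.map_eq_emit hw
    exact absurd (.emit s u F) (hu _ _ _)
  | nu hr =>
    obtain ⟨u, rfl, rfl⟩ := Tail.map_eq_nu hw
    obtain ⟨s, hs⟩ := hE.infinite_right.nonempty
    exact absurd (.nu u s F hs) (hu _ _ _)
  | spawn hr' hr =>
    obtain ⟨u', u, rfl, rfl, rfl⟩ := Tail.map_eq_spawn hw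
    exact absurd (.spawn u' u F) (hu _ _ _)
  | present hr hτ hB hb =>
    obtain ⟨s, u, b, rfl, rfl, rfl, -⟩ := Tail.map_eq_present hw
    refine irreducible_plug_await (fun hs => ?_) _
    rw [hE.eq s (hn s (by simp [Tail.names]))] at hs
    exact hu _ _ _ (.present s u b F hs)
  | awaitCall | cpsCall =>
    obtain ⟨args, rfl, rfl⟩ := Tail.map_eq_call hw
    exact absurd (.call _ args F) (hu _ _ _)

theorem Branch.map_eval {I : ℕ → Type 1} :
    ∀ {b : Branch I S}, (∀ s ∈ b.names, E (g s) = F s) → (b.eval F).map g = (b.map g).eval E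
  | .ret t, _ => by simp only [Branch.eval, Branch.map]
  | .ite s b₁ b₂, h => by
      simp only [Branch.names, List.forall_mem_cons, List.forall_mem_append] at h
      simp only [Branch.eval, Branch.map, h.1]
      split
      · exact Branch.map_eval h.2.1
      · exact Branch.map_eval h.2.2

theorem Branch.mem_names_of_mem_names_eval {I : ℕ → Type 1} {v : S} :
    ∀ {b : Branch I S}, v ∈ (b.eval F).names → v ∈ b.names
  | .ret t, h => by simpa only [Branch.eval, Branch.names] using h
  | .ite s b₁ b₂, h => by
      simp only [Branch.names, List.mem_cons, List.mem_append]
      simp only [Branch.eval] at h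
      split at h
      · exact .inr (.inl (Branch.mem_names_of_mem_names_eval h))
      · exact .inr (.inr (Branch.mem_names_of_mem_names_eval h))

theorem RepresentsHandlers.represents_eval_branch {K : Stack Id S} :
    ∀ {τ : Handlers (CpsId Id) S} {T : Thread Id S} {b : Branch (CpsId Id) S},
      RepresentsHandlers K τ → Represents (.inl (T.endInstant E) :: K) (b.eval E) →
      Represents [.inl ((K.plug T).endInstant E)] ((τ.branch b).eval E) := by
  induction K with
  | nil =>
    intro τ T b hτ hr
    cases hτ
    rwa [Handlers.branch]
  | cons x K ih =>
    intro τ T b hτ hr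
    cases hτ with
    | skip hτ => exact ih hτ (.seq hr)
    | @snoc _ _ s τ t hτ ht =>
      rw [Handlers.branch]
      refine ih (T := .watch s T) hτ ?_
      rw [Thread.endInstant, Branch.eval]
      split
      · rw [Branch.eval]
        exact .zero ht
      · exact .watch hr

theorem Matches.endInstant {T : Thread Id S} {u : Tail (CpsId Id) S} (hm : Matches g F T u)
    (hE : EnvRel J g E F) (hT : Irreducible (highLevel S eqn) E T)
    (hu : Irreducible (tailRec S (cpsEqn eqn)) F u) :
    Matches g F (T.endInstant E) (u.endInstant F) := by
  have hn := hm.2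
  obtain ⟨L, hL, hr, hnormal⟩ := hm.1.exists_normal eqn
  obtain rfl := hT.eq_of_silent hL
  generalize hw : u.map g = w at hr
  cases hr with
  | nil =>
    rw [Tail.map_eq_zero hw] at hm ⊢
    exact hm
  | zero | seq | watch | leave => exact hnormal.elim
  | @emit _ K s _ hr => exact absurd ((Thread.RedexStep.emit s E).plug K) (hT _ _ _)
  | @nu _ K U _ hr =>
    obtain ⟨s, hs⟩ := hE.infinite_left.nonempty
    exact absurd ((Thread.RedexStep.nu U s E hs).plug K) (hT _ _ _)
  | @spawn _ K U _ _ hr' hr => exact absurd ((Thread.RedexStep.spawn U E).plug K) (hT _ _ _)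
  | present hr hτ hB hb =>
    obtain ⟨s, u, b, rfl, rfl, rfl, rfl⟩ := Tail.map_eq_present hw
    simp only [Tail.names, List.forall_mem_cons, List.forall_mem_append] at hn
    rw [Tail.endInstant]
    refine ⟨?_, fun v hv => hn.2.2 v (Branch.mem_names_of_mem_names_eval hv)⟩
    rw [Branch.map_eval fun v hv => hE.eq v (hn.2.2 v hv), hb]
    refine hτ.represents_eval_branch ?_
    rw [Branch.eval]
    exact hB
  | awaitCall | cpsCall =>
    obtain ⟨args, rfl, rfl⟩ := Tail.map_eq_call hw
    exact absurd (.call _ args F) (hu _ _ _)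

theorem exists_steps_rel {α : Type*} {L : Language S} {r r' : α → L.Thr → Prop}
    (h : ∀ a T, r a T → ∃ T', ThreadSteps L T E 0 T' E ∧ r' a T') {P : Multiset α}
    {Q : Multiset L.Thr} (hPQ : Multiset.Rel r P Q) :
    ∃ Q', Relation.ReflTransGen (ProgStep L) (Q, E) (Q', E) ∧ Multiset.Rel r' P Q' := by
  suffices ∃ Q', (∀ R, Relation.ReflTransGen (ProgStep L) (R + Q, E) (R + Q', E)) ∧
      Multiset.Rel r' P Q' by
    obtain ⟨Q', hQ, hr⟩ := this
    exact ⟨Q', by simpa using hQ 0, hr⟩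
  induction hPQ with
  | zero => exact ⟨0, fun _ => .refl, .zero⟩
  | @cons a T P Q haT _ ih =>
    obtain ⟨Q', hQ, hr⟩ := ih
    obtain ⟨T', hT, hr'⟩ := h a T haT
    refine ⟨T' ::ₘ Q', fun R => ?_, .cons hr' hr⟩
    have h₁ := hQ (R + {T})
    have h₂ := hT (R + Q')
    simp only [← Multiset.singleton_add, ← add_assoc, add_zero] at h₁ h₂ ⊢
    rw [add_right_comm] at h₂
    rw [add_right_comm R {T'}]
    exact h₁.trans h₂

end Programs

/-! ### Bisimulation of the instants -/

section Instants

variable {S : Type} {Id : ℕ → Type} {Input Output : Set S}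
  {eqn : (n : ℕ) → Id n → Thread Id (Fin n)}

/-- Corresponding programs of the two languages. -/
def ProgRel (eqn : (n : ℕ) → Id n → Thread Id (Fin n)) (J : Set S) (P : Multiset (Thread Id S))
    (Q : Multiset (Tail (CpsId Id) S)) : Prop :=
  ∃ g : S → S, Set.InjOn g (J ∪ sigProg (tailRec S (cpsEqn eqn)) Q) ∧ (∀ s ∈ J, g s = s) ∧
    Multiset.Rel (fun T u => Represents [.inl T] (u.map g)) P Q

theorem progRel_cpsProg (J : Set S) (P : Multiset (Thread Id S)) :
    ProgRel eqn J P (cpsProg P) := by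
  refine ⟨id, Set.injOn_id _, fun _ _ => rfl, ?_⟩
  rw [cpsProg, Multiset.rel_map_right]
  refine Multiset.rel_refl_of_refl_on fun T _ => ?_
  have := represents_cps id T (K := []) (t := .zero) (τ := .nil)
    (by rw [Tail.map]; exact .nil) (by rw [Handlers.map]; exact .nil)
  rwa [Thread.map_id] at this

theorem finite_sigProg (L : Language S) (P : Multiset L.Thr) : (sigProg L P).Finite := by
  refine (P.bind fun T => (L.names T : Multiset S)).finite_toSet.subset ?_
  rintro s ⟨T, hT, hs⟩
  exact Multiset.mem_bind.2 ⟨T, hT, hs⟩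

theorem initEnv_eq_none_iff {L : Language S} {I : Set S} (hI : I ⊆ Input) {P : Multiset L.Thr}
    {s : S} : initEnv L Input Output I P s = none ↔ s ∉ Input ∪ Output ∪ sigProg L P := by
  rw [initEnv]
  split_ifs with h₁ h₂
  · simpa only [reduceCtorEq, false_iff, not_not] using .inl (.inl (hI h₁))
  · simpa only [reduceCtorEq, false_iff, not_not] using h₂
  · simpa only [true_iff] using h₂

theorem infinite_initEnv_eq_none (hInt : (Input ∪ Output)ᶜ.Infinite) {L : Language S} {I : Set S}
    (hI : I ⊆ Input) (P : Multiset L.Thr) :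
    {s | initEnv L Input Output I P s = none}.Infinite := by
  refine (hInt.sdiff (finite_sigProg L P)).mono ?_
  rintro s ⟨h₁, h₂⟩
  exact (initEnv_eq_none_iff hI).2 fun h => h.elim h₁ h₂

theorem ProgRel.configRel (hInt : (Input ∪ Output)ᶜ.Infinite) {P : Multiset (Thread Id S)}
    {Q : Multiset (Tail (CpsId Id) S)} (h : ProgRel eqn (Input ∪ Output) P Q) {I : Set S}
    (hI : I ⊆ Input) :
    ConfigRel (Input ∪ Output) (P, initEnv (highLevel S eqn) Input Output I P)
      (Q, initEnv (tailRec S (cpsEqn eqn)) Input Output I Q) := by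
  obtain ⟨g, hinj, hfix, hPQ⟩ := h
  have hdom : ∀ {s}, initEnv (tailRec S (cpsEqn eqn)) Input Output I Q s ≠ none ↔
      s ∈ Input ∪ Output ∪ sigProg (tailRec S (cpsEqn eqn)) Q := by
    intro s
    rw [Ne, initEnv_eq_none_iff hI, not_not]
  refine ⟨g, ⟨fun s hs => ?_, ?_, hfix, fun s hs => hdom.2 (.inl hs),
    infinite_initEnv_eq_none (L := highLevel S eqn) hInt hI P,
    infinite_initEnv_eq_none (L := tailRec S (cpsEqn eqn)) hInt hI Q⟩, ?_⟩
  · rw [hdom] at hs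
    have hgI : g s ∈ I ↔ s ∈ I := by
      constructor
      · intro h
        have h' : g s ∈ Input ∪ Output := .inl (hI h)
        rwa [← hinj (.inl h') hs (hfix _ h')]
      · intro h
        rwa [hfix s (.inl (hI h))]
    have hgs : g s ∈ Input ∪ Output ∪ sigProg (highLevel S eqn) P := by
      rcases hs with hs | ⟨u, hu, hs⟩
      · rw [hfix s hs]
        exact .inl hs
      · obtain ⟨T, hT, hr⟩ := Multiset.exists_mem_of_rel_of_mem (Multiset.rel_flip.2 hPQ) hu
        refine .inr ⟨T, hT, ?_⟩
        have := hr.names_subset (g s) (by rw [Tail.names_map]; exact List.mem_map_of_mem hs)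
        simpa [Stack.names] using this
    simp only [initEnv]
    by_cases hsI : s ∈ I
    · rw [if_pos hsI, if_pos (hgI.2 hsI)]
    · rw [if_neg hsI, if_neg (mt hgI.1 hsI), if_pos hs, if_pos hgs]
  · exact hinj.mono fun s hs => hdom.1 hs
  · exact hPQ.mono fun T _ u hu hr => ⟨hr, fun s hs => hdom.2 (.inr ⟨u, hu, hs⟩)⟩

theorem EnvRel.outputs_eq {g : S → S} {E F : Env S} (hE : EnvRel (Input ∪ Output) g E F) :
    {s | s ∈ Output ∧ E s = some true} = {s | s ∈ Output ∧ F s = some true} := by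
  ext s
  refine and_congr_right fun hs => ?_
  rw [← hE.eq s (hE.dom s (.inr hs)), hE.fixed s (.inr hs)]

theorem EnvRel.progRel_endInstant {J : Set S} {g : S → S} {E F : Env S} (hE : EnvRel J g E F)
    {P : Multiset (Thread Id S)} {Q : Multiset (Tail (CpsId Id) S)}
    (hPQ : Multiset.Rel (Matches g F) P Q) (hP : Suspended (highLevel S eqn) P E)
    (hQ : Suspended (tailRec S (cpsEqn eqn)) Q F) :
    ProgRel eqn J (P.map (Thread.endInstant E)) (Q.map (Tail.endInstant F)) := by
  have hend : Multiset.Rel (fun T u => Matches g F (T.endInstant E) (u.endInstant F)) P Q :=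
    hPQ.mono fun T hT u hu hm => hm.endInstant hE (hP T hT) (hQ u hu)
  refine ⟨g, hE.inj.mono ?_, hE.fixed, ?_⟩
  · rintro s (hs | ⟨u, hu, hs⟩)
    · exact hE.dom s hs
    · obtain ⟨u, hu', rfl⟩ := Multiset.mem_map.1 hu
      obtain ⟨T, -, hm⟩ := Multiset.exists_mem_of_rel_of_mem (Multiset.rel_flip.2 hend) hu'
      exact hm.2 s hs
  · rw [Multiset.rel_map]
    exact hend.mono fun T _ u _ hm => hm.1

theorem ProgRel.tail_simulates (hInt : (Input ∪ Output)ᶜ.Infinite) {P P' : Multiset (Thread Id S)}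
    {Q : Multiset (Tail (CpsId Id) S)} (h : ProgRel eqn (Input ∪ Output) P Q) {a : Set S × Set S}
    (hP : IOStep (highLevel S eqn) Input Output P a P') :
    ∃ Q', IOStep (tailRec S (cpsEqn eqn)) Input Output Q a Q' ∧
      ProgRel eqn (Input ∪ Output) P' Q' := by
  obtain ⟨hI, P₁, E, hsteps, hsusp, hO, rfl⟩ := hP
  obtain ⟨⟨Q₁, F⟩, hsteps', g, hE, hPQ⟩ := (h.configRel hInt hI).tail_simulates hsteps
  obtain ⟨Q₂, hsteps'', hPQ⟩ := exists_steps_rel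
    (L := tailRec S (cpsEqn eqn)) (E := F)
    (r := fun T u => Matches g F T u ∧ Irreducible (highLevel S eqn) E T)
    (r' := fun T u => Matches g F T u ∧ Irreducible (tailRec S (cpsEqn eqn)) F u)
    (fun T u hr => hr.1.exists_irreducible_tail hE hr.2)
    (hPQ.mono fun T hT u _ hm => ⟨hm, hsusp T hT⟩)
  have hsusp' : Suspended (tailRec S (cpsEqn eqn)) Q₂ F := by
    intro u hu
    obtain ⟨T, -, hm⟩ := Multiset.exists_mem_of_rel_of_mem (Multiset.rel_flip.2 hPQ) hu
    exact hm.2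
  exact ⟨_, ⟨hI, Q₂, F, hsteps'.trans hsteps'', hsusp', hO.trans hE.outputs_eq, rfl⟩,
    hE.progRel_endInstant (hPQ.mono fun _ _ _ _ hm => hm.1) hsusp hsusp'⟩

theorem ProgRel.thread_simulates (hInt : (Input ∪ Output)ᶜ.Infinite)
    {P : Multiset (Thread Id S)} {Q Q' : Multiset (Tail (CpsId Id) S)}
    (h : ProgRel eqn (Input ∪ Output) P Q) {a : Set S × Set S}
    (hQ : IOStep (tailRec S (cpsEqn eqn)) Input Output Q a Q') :
    ∃ P', IOStep (highLevel S eqn) Input Output P a P' ∧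
      ProgRel eqn (Input ∪ Output) P' Q' := by
  obtain ⟨hI, Q₁, F, hsteps, hsusp, hO, rfl⟩ := hQ
  obtain ⟨⟨P₁, E⟩, hsteps', g, hE, hPQ⟩ := (h.configRel hInt hI).thread_simulates hsteps
  obtain ⟨P₂, hsteps'', hPQ⟩ := exists_steps_rel
    (L := highLevel S eqn) (E := E)
    (r := fun u T => Matches g F T u ∧ Irreducible (tailRec S (cpsEqn eqn)) F u)
    (r' := fun u T => Matches g F T u ∧ Irreducible (highLevel S eqn) E T)
    (fun u T hr => hr.1.exists_irreducible_thread hE hr.2)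
    ((Multiset.rel_flip.2 hPQ).mono fun u hu T _ hm => ⟨hm, hsusp u hu⟩)
  replace hPQ := Multiset.rel_flip.2 hPQ
  have hsusp' : Suspended (highLevel S eqn) P₂ E := by
    intro T hT
    obtain ⟨u, -, hm⟩ := Multiset.exists_mem_of_rel_of_mem hPQ hT
    exact hm.2
  exact ⟨_, ⟨hI, P₂, E, hsteps'.trans hsteps'', hsusp', hO.trans hE.outputs_eq.symm, rfl⟩,
    hE.progRel_endInstant (hPQ.mono fun _ _ _ _ hm => hm.1) hsusp' hsusp⟩

end Instants

/-! ### Bisimilar programs have the same traces -/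

section Traces

variable {S : Type} {L L' : Language S} {Input Output : Set S}
  {R : Multiset L.Thr → Multiset L'.Thr → Prop}

theorem Run.simulates
    (hsim : ∀ {P Q a P'}, R P Q → IOStep L Input Output P a P' →
      ∃ Q', IOStep L' Input Output Q a Q' ∧ R P' Q')
    {P P' : Multiset L.Thr} {w : List (Set S × Set S)} (h : Run L Input Output P w P') :
    ∀ {Q}, R P Q → ∃ Q', Run L' Input Output Q w Q' ∧ R P' Q' := by
  induction h with
  | nil P => exact fun {Q} hR => ⟨Q, .nil Q, hR⟩
  | cons h _ ih =>
    intro Q hR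
    obtain ⟨Q₁, hQ₁, hR₁⟩ := hsim hR h
    obtain ⟨Q', hQ', hR'⟩ := ih hR₁
    exact ⟨Q', .cons hQ₁ hQ', hR'⟩

theorem tr_subset_of_bisimulation
    (hsim : ∀ {P Q a P'}, R P Q → IOStep L Input Output P a P' →
      ∃ Q', IOStep L' Input Output Q a Q' ∧ R P' Q')
    (hsim' : ∀ {P Q a Q'}, R P Q → IOStep L' Input Output Q a Q' →
      ∃ P', IOStep L Input Output P a P' ∧ R P' Q')
    {P : Multiset L.Thr} {Q : Multiset L'.Thr} (hR : R P Q) :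
    tr L Input Output P ⊆ tr L' Input Output Q := by
  rintro (w | w) hw
  · obtain ⟨P', hrun, hmax⟩ := hw
    obtain ⟨Q', hrun', hR'⟩ := hrun.simulates hsim hR
    refine ⟨Q', hrun', fun a Q'' h => ?_⟩
    obtain ⟨P'', h', -⟩ := hsim' hR' h
    exact hmax a P'' h'
  · obtain ⟨X, rfl, hX⟩ := hw
    choose! next hnext using fun (n : ℕ) (Y : Multiset L'.Thr) (h : R (X n) Y) => hsim h (hX n)
    let Y : ℕ → Multiset L'.Thr := fun n => Nat.rec Q next n
    have hY : ∀ n, R (X n) (Y n) := fun n => Nat.rec hR (fun n ih => (hnext n _ ih).2) n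
    exact ⟨Y, rfl, fun n => (hnext n _ (hY n)).1⟩

end Traces

end SL

theorem mainTheorem4 {S : Type} [Countable S] (Input Output : Set S)
    (hInt : (Input ∪ Output)ᶜ.Infinite)
    {Id : ℕ → Type} (eqn : (n : ℕ) → Id n → SL.Thread Id (Fin n))
    (P : Multiset (SL.Thread Id S)) (hP : P ≠ 0) :
    SL.tr (SL.highLevel S eqn) Input Output P =
      SL.tr (SL.tailRec S (SL.cpsEqn eqn)) Input Output (SL.cpsProg P) := by
  have hR : SL.ProgRel eqn (Input ∪ Output) P (SL.cpsProg P) := SL.progRel_cpsProg _ P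
  refine Set.Subset.antisymm ?_ ?_
  · exact SL.tr_subset_of_bisimulation (R := SL.ProgRel eqn (Input ∪ Output))
      (fun h => h.tail_simulates hInt) (fun h => h.thread_simulates hInt) hR
  · exact SL.tr_subset_of_bisimulation (R := fun Q P => SL.ProgRel eqn (Input ∪ Output) P Q)
      (fun h => h.thread_simulates hInt) (fun h => h.tail_simulates hInt) hR
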